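/- Let $d,n\ge 1$ be integers and let $d\mu=(2\pi)^{-d/2}e^{-|x|^2/2}\,dx$ be the standard Gaussian measure on $\mathbb R^d$. For $k\in\mathbb N^d$ put $|k|=\sum_j k_j$ and $H_k(x)=\prod_{j=1}^d h_{k_j}(x_j)$, where $h_m(y)=(-1)^m(m!)^{-1/2}e^{y^2/2}\frac{d^m}{dy^m}e^{-y^2/2}$ are the normalized Hermite polynomials. Let $h_1^*(s)=\dfrac{s\log s-(s-1)}{(s-1)^2}$ for $s\in(0,1)\cup(1,\infty)$, $h_1^*(0)=1$, $h_1^*(1)=\tfrac12$, and for $0\le w\in L^\infty(\mathbb R^d)$ let $\mathcal H_1[w]=\|w\|_\infty\,h_1^*(\inf w)$, with the essential supremum and infimum. Call $w$ admissible if $w\in L^\infty(\mathbb R^d)$, $w\ge 0$ a.e., $\int w\,d\mu=1$, and $\int w\,H_k\,d\mu=0$ for all $k\in\mathbb N^d$ with $0<|k|<n$. Then every admissible $w$ satisfies $$\int_{\mathbb R^d} w\log w\,d\mu\;\le\;\frac{\mathcal H_1[w]}{n}\int_{\mathbb R^d}\frac{|\nabla w|^2}{w}\,d\mu ,$$ where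 $\nabla w$ is the weak gradient and the right-hand side is $+\infty$ if $w$ has no locally integrable weak gradient. The constant $1/n$ is optimal: for all real $c<1/n$ and $\delta>0$ there is a smooth admissible $w$ with $|w-1|\le\delta$ on $\mathbb R^d$ such that $\int w\log w\,d\mu>c\,\mathcal H_1[w]\int\frac{|\nabla w|^2}{w}\,d\mu$. -/

import Mathlib

open MeasureTheory
open scoped ENNReal ContDiff

noncomputable section

namespace ImprovedLogSobolev

/-- `ℝ^d` with its Euclidean norm. -/
abbrev Space (d : ℕ) : Type := EuclideanSpace ℝ (Fin d)

/-- The Gaussian probability measure `dμ = (2π)^{-d/2} exp(-|x|²/2) dx` on `ℝ^d`. -/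
def gaussian (d : ℕ) : Measure (Space d) :=
  (volume : Measure (Space d)).withDensity fun x =>
    ENNReal.ofReal ((2 * Real.pi) ^ (-(d : ℝ) / 2) * Real.exp (-‖x‖ ^ 2 / 2))

/-- The normalized one-dimensional Hermite polynomial
`h_n(y) = (-1)^n (n!)^{-1/2} exp(y²/2) (d/dy)^n exp(-y²/2)`; `Polynomial.hermite` is the
monic (probabilists') one. -/
def hermite1 (n : ℕ) (y : ℝ) : ℝ :=
  Polynomial.aeval y (Polynomial.hermite n) / Real.sqrt (n.factorial : ℝ)

/-- The normalized Hermite polynomial `H_k(x) = ∏_j h_{k_j}(x_j)` with multi-index `k`. -/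
def hermiteMulti {d : ℕ} (k : Fin d → ℕ) (x : Space d) : ℝ :=
  ∏ j, hermite1 (k j) (x j)

/-- The continuous function `h₁` on `[0, ∞)`, with `h₁(1) = 1/2`
(the formula gives `h₁(0) = 1`, since `0 * log 0 = 0`). -/
def h1 (s : ℝ) : ℝ :=
  if s = 1 then 1 / 2 else (s * Real.log s - (s - 1)) / (s - 1) ^ 2

/-- `𝓗₁[w] = ‖w‖_∞ h₁(inf w)`, for `w ∈ L^∞`: norm and infimum are the essential ones. -/
def H1 {d : ℕ} (w : Space d → ℝ) : ℝ :=
  (eLpNorm w ∞ volume).toReal * h1 (essInf w volume)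

/-- `g` is the weak (distributional) gradient of `w` on `ℝ^d`. -/
structure HasWeakGradient {d : ℕ} (w : Space d → ℝ) (g : Space d → Space d) : Prop where
  locallyIntegrable : LocallyIntegrable w volume
  locallyIntegrable_grad : LocallyIntegrable g volume
  integral_eq : ∀ φ : Space d → ℝ, ContDiff ℝ ∞ φ → HasCompactSupport φ → ∀ i : Fin d,
    ∫ x, w x * fderiv ℝ φ x (EuclideanSpace.single i 1) = -∫ x, g x i * φ x

/-- The Fisher information `∫ |∇w|² / w dμ ∈ [0, ∞]`, with `∇w` the weak gradient.
The weak gradient is unique up to a null set, so the infimum is over at most one value;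
it is `∞` if `w` has no weak gradient. The quotient is the one of `[0, ∞]`, where
`0 / 0 = 0` and `a / 0 = ∞` for `a > 0`. -/
def fisher {d : ℕ} (w : Space d → ℝ) : ℝ≥0∞ :=
  ⨅ (g : Space d → Space d) (_ : HasWeakGradient w g),
    ∫⁻ x, ‖g x‖ₑ ^ 2 / ENNReal.ofReal (w x) ∂(gaussian d)

/-- The entropy `∫ w log w dμ`. -/
def entropy {d : ℕ} (w : Space d → ℝ) : ℝ :=
  ∫ x, w x * Real.log (w x) ∂(gaussian d)

/-- Bounded nonnegative functions with `∫ w dμ = 1` and `∫ w H_k dμ = 0` for `0 < |k| < n`. -/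
structure Admissible {d : ℕ} (n : ℕ) (w : Space d → ℝ) : Prop where
  memLp_top : MemLp w ∞ volume
  nonneg : ∀ᵐ x, 0 ≤ w x
  integral_eq_one : ∫ x, w x ∂(gaussian d) = 1
  integral_hermite : ∀ k : Fin d → ℕ, 0 < ∑ j, k j → ∑ j, k j < n →
    ∫ x, w x * hermiteMulti k x ∂(gaussian d) = 0

end ImprovedLogSobolev

end

open MeasureTheory
open scoped ENNReal ContDiff

noncomputable section

namespace ImprovedLogSobolev

/-! ### The function `h₁` -/

/-! The inequality compares both sides with the variance of `w`. Taylor's formula gives `s log s =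
(s - 1) + h1 s * (s - 1)²`, where `h1` is decreasing. Integrating against `μ` removes the linear
term, since `w` has mean 1, and leaves the entropy at most `h1 (inf w)` times the variance
(`Admissible.entropy_le`). The Hermite polynomials form a Hilbert basis of `L²(μ)`. With `c_k` the
coefficients of `w`, Gaussian integration by parts gives `∫ |∇w|² dμ = ∑ |k| c_k²`. The modes `0 <
|k| < n` are absent, so this is at least `n` times the variance (`mul_integral_sq_sub_one_le`).
Finally `|∇w|² ≤ ‖w‖_∞ |∇w|² / w`.

For optimality, linearize at the constant 1: for `w = 1 + ε f` with `ε` small, `H1 w` is close to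
`1/2`, the entropy to `ε²/2 ∫ f²` and the Fisher information to `ε² ∫ |∇f|²`. What is needed is a
bounded smooth `f` without modes below `n` whose ratio `∫ |∇f|² / ∫ f²` is close to `n`. A Hermite
polynomial of degree `n` has ratio exactly `n` but is unbounded. It is replaced by an `n`-th finite
difference, of step `τ`, of the generating function `t ↦ exp (t²/2) cos (t x + θ)`. The difference
kills the modes below `n`, and mode `n` dominates as `τ → 0`. Both integrals are power series in
`τ²` with explicit nonnegative coefficients, and `exists_mul_lt_of_hasSum` compares them. -/

theorem mul_log_eq_add_h1_mul_sq (s : ℝ) :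
    s * Real.log s = (s - 1) + h1 s * (s - 1) ^ 2 := by
  unfold h1
  split_ifs with h
  · simp [h]
  · have : s - 1 ≠ 0 := sub_ne_zero.2 h
    field_simp
    ring

/-- The expression is the convex combination `(1 - u) + u s`, the point at which the second
derivative `1 / x` of `x log x` is taken in the remainder. -/
theorem one_add_mul_sub_one_pos {s u : ℝ} (hs : 0 < s) (hu : u ∈ Set.Icc (0 : ℝ) 1) :
    0 < 1 + u * (s - 1) := by
  rcases eq_or_lt_of_le hu.1 with h | h
  · simp [← h]
  · nlinarith [hu.2, mul_pos h hs]

theorem continuousOn_h1_integrand {s : ℝ} (hs : 0 < s) :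
    ContinuousOn (fun u : ℝ => (1 - u) / (1 + u * (s - 1))) (Set.Icc 0 1) :=
  ContinuousOn.div (by fun_prop) (by fun_prop) fun _ hu => (one_add_mul_sub_one_pos hs hu).ne'

theorem intervalIntegrable_h1_integrand {s : ℝ} (hs : 0 < s) :
    IntervalIntegrable (fun u : ℝ => (1 - u) / (1 + u * (s - 1))) volume 0 1 :=
  ContinuousOn.intervalIntegrable_of_Icc zero_le_one (continuousOn_h1_integrand hs)

theorem integral_one_sub : ∫ u in (0 : ℝ)..1, (1 - u) = 1 / 2 := by
  rw [intervalIntegral.integral_sub (by simp) (by simp)]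
  simp
  norm_num

/-- The integral remainder of Taylor's formula for `s log s` at `s = 1`. -/
theorem h1_eq_integral {s : ℝ} (hs : 0 < s) :
    h1 s = ∫ u in (0 : ℝ)..1, (1 - u) / (1 + u * (s - 1)) := by
  rcases eq_or_ne s 1 with rfl | h
  · simp [h1, integral_one_sub]
  · have ha : s - 1 ≠ 0 := sub_ne_zero.2 h
    have key : ∀ u ∈ Set.uIcc (0 : ℝ) 1, HasDerivAt
        (fun u : ℝ => -u / (s - 1) + s / (s - 1) ^ 2 * Real.log (1 + u * (s - 1)))
        ((1 - u) / (1 + u * (s - 1))) u := by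
      intro u hu
      rw [Set.uIcc_of_le zero_le_one] at hu
      have hp := (one_add_mul_sub_one_pos hs hu).ne'
      have h1 : HasDerivAt (fun u : ℝ => 1 + u * (s - 1)) (s - 1) u := by
        simpa using ((hasDerivAt_id u).mul_const (s - 1)).const_add 1
      have h2 := ((hasDerivAt_id u).neg.div_const (s - 1)).add
        ((h1.log hp).const_mul (s / (s - 1) ^ 2))
      refine h2.congr_deriv ?_
      obtain ⟨p, hpu⟩ : ∃ p, p = 1 + u * (s - 1) := ⟨_, rfl⟩
      rw [← hpu] at hp ⊢
      field_simp
      rw [hpu]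
      ring
    rw [intervalIntegral.integral_eq_sub_of_hasDerivAt key (intervalIntegrable_h1_integrand hs),
      h1, if_neg h]
    simp only [one_mul, zero_mul, add_zero, add_sub_cancel, Real.log_one, mul_zero, neg_zero,
      zero_div, sub_zero]
    field_simp
    ring

theorem h1_zero : h1 0 = 1 := by simp [h1]

theorem h1_le_one {s : ℝ} (hs : 0 < s) : h1 s ≤ 1 := by
  rw [h1_eq_integral hs]
  calc _ ≤ ∫ u in (0 : ℝ)..1, (1 : ℝ) :=
        intervalIntegral.integral_mono_on zero_le_one (intervalIntegrable_h1_integrand hs)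
          (by simp) fun u hu => by
            rw [div_le_one (one_add_mul_sub_one_pos hs hu)]
            nlinarith [mul_nonneg hu.1 hs.le]
    _ = 1 := by simp

theorem h1_le_h1_of_pos {s t : ℝ} (hs : 0 < s) (hst : s ≤ t) : h1 t ≤ h1 s := by
  rw [h1_eq_integral hs, h1_eq_integral (hs.trans_le hst)]
  refine intervalIntegral.integral_mono_on zero_le_one
    (intervalIntegrable_h1_integrand (hs.trans_le hst)) (intervalIntegrable_h1_integrand hs)
    fun u hu => ?_
  refine div_le_div_of_nonneg_left (by linarith [hu.2]) (one_add_mul_sub_one_pos hs hu) ?_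
  have := hu.1
  gcongr

/-- The integrand of `h1_eq_integral` decreases in `s`. That formula needs `s > 0`; the endpoint 0
is covered by `h1_le_one`. -/
theorem h1_antitoneOn : AntitoneOn h1 (Set.Ici 0) := by
  intro s hs t ht hst
  rcases eq_or_lt_of_le (Set.mem_Ici.1 hs) with rfl | h
  · rcases eq_or_lt_of_le (Set.mem_Ici.1 ht) with rfl | h'
    · rfl
    · exact h1_zero ▸ h1_le_one h'
  · exact h1_le_h1_of_pos h hst

/-- Here the convex combination of 1 and `s` is at least `s`. Together with `inv_le_h1` this makes
`h1 s → 1/2` as `s → 1` quantitative, which is what the optimality part uses. -/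
theorem h1_le_inv {s : ℝ} (hs : 0 < s) (hs1 : s ≤ 1) : h1 s ≤ 1 / 2 / s := by
  rw [h1_eq_integral hs, ← integral_one_sub, ← intervalIntegral.integral_div]
  refine intervalIntegral.integral_mono_on zero_le_one (intervalIntegrable_h1_integrand hs)
    (Continuous.intervalIntegrable (by fun_prop) _ _) fun u hu => ?_
  refine div_le_div_of_nonneg_left (by linarith [hu.2]) hs ?_
  nlinarith [hu.2]

theorem inv_le_h1 {s : ℝ} (hs1 : 1 ≤ s) : 1 / 2 / s ≤ h1 s := by
  have hs : 0 < s := by linarith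
  rw [h1_eq_integral hs, ← integral_one_sub, ← intervalIntegral.integral_div]
  refine intervalIntegral.integral_mono_on zero_le_one
    (Continuous.intervalIntegrable (by fun_prop) _ _) (intervalIntegrable_h1_integrand hs)
    fun u hu => ?_
  refine div_le_div_of_nonneg_left (by linarith [hu.2]) (one_add_mul_sub_one_pos hs hu) ?_
  nlinarith [hu.2]

theorem h1_pos {s : ℝ} (hs : 0 ≤ s) : 0 < h1 s := by
  have h : 1 ≤ s + 1 := by linarith
  calc 0 < 1 / 2 / (s + 1) := by positivity
    _ ≤ h1 (s + 1) := inv_le_h1 h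
    _ ≤ h1 s := h1_antitoneOn hs (Set.mem_Ici.2 (by linarith)) (by linarith)

section

/-! ### The Gaussian measure -/

/-- The density of the Gaussian measure. -/
def density (d : ℕ) (x : Space d) : ℝ :=
  (2 * Real.pi) ^ (-(d : ℝ) / 2) * Real.exp (-‖x‖ ^ 2 / 2)

variable {d : ℕ}

theorem density_pos (x : Space d) : 0 < density d x := by
  unfold density
  positivity

theorem contDiff_density : ContDiff ℝ ∞ (density d) := by
  unfold density
  have : ContDiff ℝ ∞ (fun x : Space d => ‖x‖ ^ 2) := contDiff_norm_sq ℝ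
  fun_prop

theorem continuous_density : Continuous (density d) := contDiff_density.continuous

theorem gaussian_eq_withDensity :
    gaussian d = volume.withDensity fun x => ENNReal.ofReal (density d x) := rfl

theorem measurable_ofReal_density : Measurable fun x => ENNReal.ofReal (density d x) :=
  continuous_density.measurable.ennreal_ofReal

theorem integral_gaussian {E : Type*} [NormedAddCommGroup E] [NormedSpace ℝ E]
    (f : Space d → E) : ∫ x, f x ∂(gaussian d) = ∫ x, density d x • f x := by
  rw [gaussian_eq_withDensity, integral_withDensity_eq_integral_toReal_smul
    measurable_ofReal_density (by simp)]
  simp only [ENNReal.toReal_ofReal (density_pos _).le]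

theorem integrable_gaussian_iff {E : Type*} [NormedAddCommGroup E] [NormedSpace ℝ E]
    {f : Space d → E} :
    Integrable f (gaussian d) ↔ Integrable (fun x => density d x • f x) volume := by
  rw [gaussian_eq_withDensity, integrable_withDensity_iff_integrable_smul'
    measurable_ofReal_density (by simp)]
  simp only [ENNReal.toReal_ofReal (density_pos _).le]

theorem gaussian_absolutelyContinuous : gaussian d ≪ volume :=
  withDensity_absolutelyContinuous _ _

/-- The characteristic function of the Gaussian. The total mass and all cosine integrals below are
read off from it. -/
theorem integral_cexp_inner (t : Space d) :
    ∫ x, Complex.exp (Complex.I * inner ℝ t x) ∂(gaussian d) = Complex.exp (-‖t‖ ^ 2 / 2) := by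
  have h := GaussianFourier.integral_cexp_neg_mul_sq_norm_add (b := 1 / 2) (by norm_num)
    Complex.I t
  have h2 : ∀ x : Space d, density d x • Complex.exp (Complex.I * inner ℝ t x) =
      ((2 * Real.pi) ^ (-(d : ℝ) / 2) : ℝ) *
        Complex.exp (-(1 / 2) * ‖x‖ ^ 2 + Complex.I * inner ℝ t x) := by
    intro x
    rw [density, Complex.exp_add, Complex.real_smul]
    push_cast
    ring_nf
  rw [integral_gaussian]
  simp_rw [h2]
  rw [integral_const_mul, h, ← mul_assoc]
  have h3 : (((2 * Real.pi) ^ (-(d : ℝ) / 2) : ℝ) : ℂ) *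
      (Real.pi / (1 / 2)) ^ ((Module.finrank ℝ (Space d) : ℂ) / 2) = 1 := by
    have : ((Real.pi : ℂ) / (1 / 2)) ^ ((Module.finrank ℝ (Space d) : ℂ) / 2) =
        (((2 * Real.pi) ^ ((d : ℝ) / 2) : ℝ) : ℂ) := by
      rw [Complex.ofReal_cpow (by positivity)]
      simp only [finrank_euclideanSpace, Fintype.card_fin]
      push_cast
      congr 1
      ring
    rw [this, ← Complex.ofReal_mul, ← Real.rpow_add (by positivity)]
    norm_num [neg_div]
  rw [h3, one_mul, Complex.I_sq]
  congr 1
  ring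

instance isProbabilityMeasure_gaussian : IsProbabilityMeasure (gaussian d) := by
  have h := integral_cexp_inner (0 : Space d)
  simp only [inner_zero_left, Complex.ofReal_zero, mul_zero, Complex.exp_zero, norm_zero,
    integral_const, ne_eq, OfNat.ofNat_ne_zero, not_false_eq_true, zero_pow, neg_zero,
    zero_div] at h
  refine ⟨?_⟩
  have h1 : (gaussian d).real Set.univ = 1 := by
    rw [Complex.real_smul, mul_one] at h
    exact_mod_cast h
  rw [Measure.real, ENNReal.toReal_eq_one_iff] at h1
  exact h1

/-- Since `a r ≤ a² + r²/4`, half of the Gaussian exponent absorbs the exponential. -/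
theorem integrable_exp_mul_norm (a : ℝ) :
    Integrable (fun x : Space d => Real.exp (a * ‖x‖)) (gaussian d) := by
  rw [integrable_gaussian_iff]
  have h := (GaussianFourier.integrable_cexp_neg_mul_sq_norm_add (V := Space d) (b := 1 / 4)
    (by norm_num) 0 0).norm.const_mul ((2 * Real.pi) ^ (-(d : ℝ) / 2) * Real.exp (a ^ 2))
  refine h.mono' ?_ (Filter.Eventually.of_forall fun x => ?_)
  · exact (continuous_density.smul (by fun_prop)).aestronglyMeasurable
  · have : ‖Complex.exp (-(1 / 4) * ‖x‖ ^ 2 + 0 * inner ℝ 0 x)‖ = Real.exp (-(1 / 4) * ‖x‖ ^ 2) := by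
      rw [Complex.norm_exp]
      congr 1
      simp [← Complex.ofReal_pow]
    rw [this, density, smul_eq_mul, Real.norm_of_nonneg (by positivity), mul_assoc, mul_assoc,
      ← Real.exp_add, ← Real.exp_add]
    refine mul_le_mul_of_nonneg_left (Real.exp_le_exp.2 ?_) (by positivity)
    nlinarith [sq_nonneg (a - ‖x‖ / 2)]

/-- Continuous functions of at most exponential growth. -/
def ExpGrowth (f : Space d → ℝ) : Prop :=
  Continuous f ∧ ∃ C a : ℝ, ∀ x, |f x| ≤ C * Real.exp (a * ‖x‖)

theorem ExpGrowth.memLp {f : Space d → ℝ} (hf : ExpGrowth f) : MemLp f 2 (gaussian d) := by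
  obtain ⟨hc, C, a, h⟩ := hf
  rw [memLp_two_iff_integrable_sq hc.aestronglyMeasurable]
  refine ((integrable_exp_mul_norm (2 * a)).const_mul (C ^ 2)).mono'
    (hc.pow 2).aestronglyMeasurable (Filter.Eventually.of_forall fun x => ?_)
  rw [Real.norm_eq_abs, abs_pow, mul_assoc, two_mul, ← two_mul, show
    Real.exp (2 * (a * ‖x‖)) = Real.exp (a * ‖x‖) ^ 2 by rw [← Real.exp_nat_mul]; norm_num,
    ← mul_pow]
  exact pow_le_pow_left₀ (abs_nonneg _) (h x) 2

theorem ExpGrowth.mul {f g : Space d → ℝ} (hf : ExpGrowth f) (hg : ExpGrowth g) :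
    ExpGrowth fun x => f x * g x := by
  obtain ⟨hfc, C, a, hf⟩ := hf
  obtain ⟨hgc, D, b, hg⟩ := hg
  refine ⟨hfc.mul hgc, C * D, a + b, fun x => ?_⟩
  rw [abs_mul, add_mul, Real.exp_add, mul_mul_mul_comm]
  exact mul_le_mul (hf x) (hg x) (abs_nonneg _) ((abs_nonneg _).trans (hf x))

theorem ExpGrowth.add {f g : Space d → ℝ} (hf : ExpGrowth f) (hg : ExpGrowth g) :
    ExpGrowth fun x => f x + g x := by
  obtain ⟨hfc, C, a, hf⟩ := hf
  obtain ⟨hgc, D, b, hg⟩ := hg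
  refine ⟨hfc.add hgc, |C| + |D|, max a b, fun x => ?_⟩
  rw [add_mul]
  refine (abs_add_le _ _).trans (add_le_add ?_ ?_)
  · exact (hf x).trans (mul_le_mul (le_abs_self C) (Real.exp_le_exp.2 (mul_le_mul_of_nonneg_right
      (le_max_left a b) (norm_nonneg x))) (Real.exp_pos _).le (abs_nonneg _))
  · exact (hg x).trans (mul_le_mul (le_abs_self D) (Real.exp_le_exp.2 (mul_le_mul_of_nonneg_right
      (le_max_right a b) (norm_nonneg x))) (Real.exp_pos _).le (abs_nonneg _))

theorem expGrowth_of_bounded {f : Space d → ℝ} (hf : Continuous f) {C : ℝ}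
    (h : ∀ x, |f x| ≤ C) : ExpGrowth f :=
  ⟨hf, C, 0, by simpa using h⟩

theorem expGrowth_const (c : ℝ) : ExpGrowth fun _ : Space d => c :=
  expGrowth_of_bounded continuous_const fun _ => le_rfl

theorem expGrowth_coord (i : Fin d) : ExpGrowth fun x : Space d => x i := by
  refine ⟨by fun_prop, 1, 1, fun x => ?_⟩
  have h := PiLp.norm_apply_le x i
  rw [Real.norm_eq_abs] at h
  simp only [one_mul]
  linarith [Real.add_one_le_exp ‖x‖]

theorem expGrowth_prod {ι : Type*} (s : Finset ι) {f : ι → Space d → ℝ}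
    (hf : ∀ i ∈ s, ExpGrowth (f i)) : ExpGrowth fun x => ∏ i ∈ s, f i x := by
  classical
  induction s using Finset.induction_on with
  | empty => simpa using expGrowth_const 1
  | insert i s hi ih =>
    simp only [Finset.prod_insert hi]
    exact (hf i (Finset.mem_insert_self _ _)).mul
      (ih fun j hj => hf j (Finset.mem_insert_of_mem hj))

theorem expGrowth_aeval {f : Space d → ℝ} (hf : ExpGrowth f) (p : Polynomial ℤ) :
    ExpGrowth fun x => Polynomial.aeval (f x) p := by
  induction p using Polynomial.induction_on' with
  | add p q hp hq => simpa using hp.add hq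
  | monomial n c =>
    simp only [Polynomial.aeval_monomial]
    refine (expGrowth_const _).mul ?_
    simpa using expGrowth_prod (Finset.range n) (f := fun _ => f) fun _ _ => hf

end

section

variable {d : ℕ}

/-! ### Hermite polynomials -/

/-- At `n = 0` the truncated `n - 1` is harmless because its factor vanishes. The same convention
reappears in `hermite1` identities and in `lower`. -/
theorem derivative_hermite (n : ℕ) :
    Polynomial.derivative (Polynomial.hermite n) = n * Polynomial.hermite (n - 1) := by
  induction n with
  | zero => simp
  | succ n ih =>
    rw [Polynomial.hermite_succ, Polynomial.derivative_sub, Polynomial.derivative_mul, ih,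
      Polynomial.derivative_X, Polynomial.derivative_natCast_mul, Nat.add_sub_cancel]
    rcases n with _ | n
    · simp
    · rw [Nat.add_sub_cancel, Polynomial.hermite_succ n]
      push_cast
      ring

theorem hermite1_zero (y : ℝ) : hermite1 0 y = 1 := by simp [hermite1]

theorem sqrt_mul_hermite1_pred (n : ℕ) (y : ℝ) :
    √(n : ℝ) * hermite1 (n - 1) y =
      n * Polynomial.aeval y (Polynomial.hermite (n - 1)) / √(n.factorial : ℝ) := by
  rcases n with _ | n
  · simp
  · have h1 : (0 : ℝ) < √((n + 1 : ℕ) : ℝ) := by positivity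
    have h2 : (0 : ℝ) < √(n.factorial : ℝ) := by positivity
    have h3 : √((n + 1 : ℕ) : ℝ) ^ 2 = ((n + 1 : ℕ) : ℝ) := Real.sq_sqrt (by positivity)
    rw [hermite1, Nat.factorial_succ, Nat.cast_mul, Real.sqrt_mul (by positivity),
      Nat.add_sub_cancel]
    field_simp
    rw [h3, mul_comm]

theorem hasDerivAt_hermite1 (n : ℕ) (y : ℝ) :
    HasDerivAt (hermite1 n) (√(n : ℝ) * hermite1 (n - 1) y) y := by
  have h := ((Polynomial.hermite n).hasDerivAt_aeval y).div_const √(n.factorial : ℝ)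
  rw [derivative_hermite] at h
  rw [sqrt_mul_hermite1_pred]
  refine h.congr_deriv ?_
  simp

theorem hermite1_succ (n : ℕ) (y : ℝ) :
    √((n : ℝ) + 1) * hermite1 (n + 1) y = y * hermite1 n y - √(n : ℝ) * hermite1 (n - 1) y := by
  have h1 : (0 : ℝ) < √((n : ℝ) + 1) := by positivity
  have h2 : (0 : ℝ) < √(n.factorial : ℝ) := by positivity
  rw [sqrt_mul_hermite1_pred, hermite1, hermite1, Polynomial.hermite_succ, derivative_hermite,
    Nat.factorial_succ, Nat.cast_mul, Real.sqrt_mul (by positivity)]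
  simp
  field_simp

theorem contDiff_hermite1 (n : ℕ) : ContDiff ℝ ∞ (hermite1 n) :=
  (Polynomial.contDiff_aeval _ _).div_const _

theorem contDiff_hermiteMulti (k : Fin d → ℕ) : ContDiff ℝ ∞ (hermiteMulti k) := by
  unfold hermiteMulti
  refine contDiff_prod fun j _ => ?_
  exact (contDiff_hermite1 _).comp (by fun_prop)

theorem expGrowth_hermiteMulti (k : Fin d → ℕ) : ExpGrowth (hermiteMulti k) := by
  refine expGrowth_prod Finset.univ fun j _ => ?_
  simp only [hermite1, div_eq_mul_inv]
  exact (expGrowth_aeval (expGrowth_coord j) _).mul (expGrowth_const _)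

theorem hermiteMulti_zero (x : Space d) : hermiteMulti 0 x = 1 := by
  simp [hermiteMulti, hermite1_zero]

theorem hermiteMulti_update (k : Fin d → ℕ) (i : Fin d) (m : ℕ) (x : Space d) :
    hermiteMulti (Function.update k i m) x =
      hermite1 m (x i) * ∏ j ∈ Finset.univ.erase i, hermite1 (k j) (x j) := by
  rw [hermiteMulti, ← Finset.mul_prod_erase _ _ (Finset.mem_univ i)]
  simp only [Function.update_self]
  congr 1
  refine Finset.prod_congr rfl fun j hj => ?_
  rw [Function.update_of_ne (Finset.ne_of_mem_erase hj)]

theorem hermiteMulti_eq_mul (k : Fin d → ℕ) (i : Fin d) (x : Space d) :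
    hermiteMulti k x =
      hermite1 (k i) (x i) * ∏ j ∈ Finset.univ.erase i, hermite1 (k j) (x j) := by
  rw [← hermiteMulti_update, Function.update_eq_self]

/-- The multi-index `k + e_i`. -/
def raise (i : Fin d) (k : Fin d → ℕ) : Fin d → ℕ := Function.update k i (k i + 1)

/-- The multi-index `k - e_i`, or `k` if `k_i = 0`. -/
def lower (i : Fin d) (k : Fin d → ℕ) : Fin d → ℕ := Function.update k i (k i - 1)

theorem hermiteMulti_raise (k : Fin d → ℕ) (i : Fin d) (x : Space d) :
    √((k i : ℝ) + 1) * hermiteMulti (raise i k) x =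
      x i * hermiteMulti k x - √(k i : ℝ) * hermiteMulti (lower i k) x := by
  rw [raise, lower, hermiteMulti_update, hermiteMulti_update, hermiteMulti_eq_mul k i,
    ← mul_assoc, hermite1_succ]
  ring

theorem fderiv_hermiteMulti (k : Fin d → ℕ) (i : Fin d) (x : Space d) :
    fderiv ℝ (hermiteMulti k) x (EuclideanSpace.single i 1) =
      √(k i : ℝ) * hermiteMulti (lower i k) x := by
  have hd : DifferentiableAt ℝ (hermiteMulti k) x :=
    (contDiff_hermiteMulti k).differentiable (by simp) x
  rw [← hd.lineDeriv_eq_fderiv, lower, hermiteMulti_update, ← mul_assoc]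
  refine HasLineDerivAt.lineDeriv ?_
  unfold HasLineDerivAt
  have h1 : (fun t : ℝ => hermiteMulti k (x + t • EuclideanSpace.single i 1)) = fun t =>
      hermite1 (k i) (x i + t) * ∏ j ∈ Finset.univ.erase i, hermite1 (k j) (x j) := by
    ext t
    rw [hermiteMulti_eq_mul k i]
    congr 1
    · simp
    · refine Finset.prod_congr rfl fun j hj => ?_
      simp [Finset.ne_of_mem_erase hj]
  rw [h1]
  refine HasDerivAt.mul_const ?_ _
  have h2 : HasDerivAt (hermite1 (k i)) (√(k i : ℝ) * hermite1 (k i - 1) (x i)) (x i + 0) := by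
    rw [add_zero]
    exact hasDerivAt_hermite1 _ _
  exact h2.comp_const_add (x i) 0

theorem fderiv_density (i : Fin d) (x : Space d) :
    fderiv ℝ (density d) x (EuclideanSpace.single i 1) = -(x i * density d x) := by
  have h := ((((hasStrictFDerivAt_norm_sq x).hasFDerivAt.neg.mul_const (2⁻¹ : ℝ)).exp).const_mul
    ((2 * Real.pi) ^ (-(d : ℝ) / 2)))
  have h2 : density d = fun y : Space d => (2 * Real.pi) ^ (-(d : ℝ) / 2) *
      Real.exp ((-fun x : Space d => ‖x‖ ^ 2) y * 2⁻¹) := by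
    ext y
    rw [density, div_eq_mul_inv (-‖y‖ ^ 2) 2]
    rfl
  rw [h2, HasFDerivAt.fderiv h]
  simp [EuclideanSpace.inner_single_right]
  ring

/-- Differentiating against the Gaussian weight acts as the creation operator: the lowering terms
from the derivative and from the recurrence cancel. Integration by parts therefore shifts Hermite
coefficients by `e_i`. -/
theorem fderiv_hermiteMulti_mul_density (k : Fin d → ℕ) (i : Fin d) (x : Space d) :
    fderiv ℝ (fun x => hermiteMulti k x * density d x) x (EuclideanSpace.single i 1) =
      -(√((k i : ℝ) + 1) * hermiteMulti (raise i k) x * density d x) := by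
  have hd : DifferentiableAt ℝ (hermiteMulti k) x :=
    (contDiff_hermiteMulti k).differentiable (by simp) x
  have hd' : DifferentiableAt ℝ (density d) x := contDiff_density.differentiable (by simp) x
  rw [fderiv_fun_mul hd hd', hermiteMulti_raise]
  simp only [FunLike.coe_add, FunLike.coe_smul, Pi.add_apply, Pi.smul_apply, smul_eq_mul,
    fderiv_density, fderiv_hermiteMulti]
  ring

end

section

variable {d : ℕ}

open Filter Topology

/-! ### Weak gradients -/

theorem exists_cutoff (d : ℕ) : ∃ χ : Space d → ℝ, ContDiff ℝ ∞ χ ∧ HasCompactSupport χ ∧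
    χ 0 = 1 ∧ (∀ x, |χ x| ≤ 1) ∧
    ∃ K, ∀ x (i : Fin d), |fderiv ℝ χ x (EuclideanSpace.single i 1)| ≤ K := by
  let f : ContDiffBump (0 : Space d) := ⟨1, 2, one_pos, one_lt_two⟩
  have hc : Continuous (fderiv ℝ (f : Space d → ℝ)) :=
    (f.contDiff (n := 1)).continuous_fderiv (by simp)
  obtain ⟨K, hK⟩ := (f.hasCompactSupport.fderiv ℝ).exists_bound_of_continuous hc
  refine ⟨f, f.contDiff, f.hasCompactSupport, f.one_of_mem_closedBall (by simp [f]), fun x => ?_,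
    K, fun x i => ?_⟩
  · rw [abs_of_nonneg f.nonneg]
    exact f.le_one
  · rw [← Real.norm_eq_abs]
    refine (ContinuousLinearMap.le_opNorm _ _).trans ?_
    simpa using hK x

/-- Gaussian integration by parts: the Hermite coefficients of a weak gradient. -/
theorem integral_weakGradient_mul_hermiteMulti {w : Space d → ℝ} {g : Space d → Space d}
    (h : HasWeakGradient w g) (hw : MemLp w 2 (gaussian d)) {i : Fin d}
    (hg : MemLp (fun x => g x i) 2 (gaussian d)) (k : Fin d → ℕ) :
    ∫ x, g x i * hermiteMulti k x ∂(gaussian d) =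
      √((k i : ℝ) + 1) * ∫ x, w x * hermiteMulti (raise i k) x ∂(gaussian d) := by
  obtain ⟨χ, hχ, hχs, hχ0, hχ1, K, hK⟩ := exists_cutoff d
  let e : Space d := EuclideanSpace.single i 1
  let c : ℕ → ℝ := fun m => 1 / ((m : ℝ) + 1)
  have hc0 : ∀ m, c m ≠ 0 := fun m => by positivity
  have hcpos : ∀ m, 0 < c m := fun m => by positivity
  have hcle : ∀ m, c m ≤ 1 := fun m => by
    rw [div_le_one (by positivity)]
    linarith [(Nat.cast_nonneg m : (0 : ℝ) ≤ m)]
  have hct : Tendsto c atTop (𝓝 0) := tendsto_one_div_add_atTop_nhds_zero_nat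
  have hχc : ∀ x, Tendsto (fun m => χ (c m • x)) atTop (𝓝 1) := fun x => by
    rw [← hχ0]
    refine (hχ.continuous.tendsto 0).comp ?_
    simpa using hct.smul_const x
  let F : Space d → ℝ := fun x => hermiteMulti k x * density d x
  have hF : ContDiff ℝ ∞ F := (contDiff_hermiteMulti k).mul contDiff_density
  -- `H_k` times the density is not compactly supported, so it is cut off at scale `m + 1`. The
  -- derivative of the cutoff carries the factor `c m → 0` and drops out in the limit.
  let φ : ℕ → Space d → ℝ := fun m x => χ (c m • x) * F x
  have hφ : ∀ m, ContDiff ℝ ∞ (φ m) := fun m => (hχ.comp (contDiff_const_smul (c m))).mul hF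
  have hφs : ∀ m, HasCompactSupport (φ m) := fun m =>
    (hχs.comp_smul (hc0 m)).mul_right
  have hφ' : ∀ m x, fderiv ℝ (φ m) x e =
      c m * fderiv ℝ χ (c m • x) e * F x -
      χ (c m • x) * (√((k i : ℝ) + 1) * hermiteMulti (raise i k) x * density d x) := by
    intro m x
    have h1 : HasFDerivAt (fun x => χ (c m • x))
        ((fderiv ℝ χ (c m • x)).comp (c m • ContinuousLinearMap.id ℝ (Space d))) x :=
      (hχ.differentiable (by simp) (c m • x)).hasFDerivAt.comp x
        ((hasFDerivAt_id x).const_smul (c m))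
    have h2 := (hF.differentiable (by simp) x).hasFDerivAt
    have h3 := (h1.mul h2).fderiv
    change fderiv ℝ (φ m) x = _ at h3
    rw [h3]
    simp only [FunLike.coe_add, FunLike.coe_smul, Pi.add_apply, Pi.smul_apply, smul_eq_mul,
      ContinuousLinearMap.comp_apply, ContinuousLinearMap.id_apply, map_smul]
    rw [show fderiv ℝ F x e = _ from fderiv_hermiteMulti_mul_density k i x]
    ring
  have hgH : Integrable (fun x => density d x • (g x i * hermiteMulti k x)) :=
    integrable_gaussian_iff.1 (hg.integrable_mul (expGrowth_hermiteMulti k).memLp)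
  have hwH : ∀ l, Integrable (fun x => density d x • (w x * hermiteMulti l x)) := fun l =>
    integrable_gaussian_iff.1 (hw.integrable_mul (expGrowth_hermiteMulti l).memLp)
  have lim1 : Tendsto (fun m => ∫ x, g x i * φ m x) atTop
      (𝓝 (∫ x, density d x • (g x i * hermiteMulti k x))) := by
    refine tendsto_integral_of_dominated_convergence
      (fun x => ‖density d x • (g x i * hermiteMulti k x)‖) (fun m => ?_) hgH.norm
      (fun m => Eventually.of_forall fun x => ?_) (Eventually.of_forall fun x => ?_)
    · have : (fun x => g x i * φ m x) =
          fun x => χ (c m • x) * density d x • (g x i * hermiteMulti k x) := by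
        ext x
        simp only [φ, F, smul_eq_mul]
        ring
      rw [this]
      exact (hχ.continuous.comp (continuous_const_smul (c m))).aestronglyMeasurable.mul hgH.1
    · have : g x i * φ m x = χ (c m • x) * (density d x • (g x i * hermiteMulti k x)) := by
        simp only [φ, F, smul_eq_mul]
        ring
      rw [this, norm_mul]
      exact mul_le_of_le_one_left (norm_nonneg _) (hχ1 _)
    · have := (hχc x).mul_const (density d x • (g x i * hermiteMulti k x))
      rw [one_mul] at this
      refine this.congr fun m => ?_
      simp only [φ, F, smul_eq_mul]
      ring
  have lim2 : Tendsto (fun m => ∫ x, w x * fderiv ℝ (φ m) x e) atTop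
      (𝓝 (∫ x, -(√((k i : ℝ) + 1) * (density d x • (w x * hermiteMulti (raise i k) x))))) := by
    have heq : ∀ m x, w x * fderiv ℝ (φ m) x e =
        c m * fderiv ℝ χ (c m • x) e * (density d x • (w x * hermiteMulti k x)) -
        χ (c m • x) * (√((k i : ℝ) + 1) * (density d x • (w x * hermiteMulti (raise i k) x))) := by
      intro m x
      rw [hφ']
      simp only [F, smul_eq_mul]
      ring
    simp only [heq]
    refine tendsto_integral_of_dominated_convergence
      (fun x => K * ‖density d x • (w x * hermiteMulti k x)‖ +
        ‖√((k i : ℝ) + 1) * (density d x • (w x * hermiteMulti (raise i k) x))‖) (fun m => ?_)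
      (((hwH k).norm.const_mul K).add ((hwH (raise i k)).const_mul _).norm)
      (fun m => Eventually.of_forall fun x => ?_) (Eventually.of_forall fun x => ?_)
    · have hχ' : Continuous fun x => c m * fderiv ℝ χ (c m • x) e :=
        continuous_const.mul (((hχ.continuous_fderiv (by simp)).comp
          (continuous_const_smul (c m))).clm_apply continuous_const)
      exact (hχ'.aestronglyMeasurable.mul (hwH k).1).sub
        ((hχ.continuous.comp (continuous_const_smul (c m))).aestronglyMeasurable.mul
          ((hwH (raise i k)).const_mul _).1)
    · refine (norm_sub_le _ _).trans (add_le_add ?_ ?_)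
      · rw [norm_mul]
        refine mul_le_mul_of_nonneg_right ?_ (norm_nonneg _)
        rw [norm_mul, Real.norm_of_nonneg (hcpos m).le]
        exact (mul_le_of_le_one_left (norm_nonneg _) (hcle m)).trans (hK _ _)
      · rw [norm_mul]
        exact mul_le_of_le_one_left (norm_nonneg _) (hχ1 _)
    · have h1 : Tendsto (fun m => c m * fderiv ℝ χ (c m • x) e) atTop (𝓝 0) := by
        refine squeeze_zero_norm (fun m => ?_) (by simpa using hct.mul_const K)
        rw [norm_mul, Real.norm_of_nonneg (hcpos m).le]
        exact mul_le_mul_of_nonneg_left (hK _ _) (hcpos m).le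
      have := (h1.mul_const (density d x • (w x * hermiteMulti k x))).sub ((hχc x).mul_const
        (√((k i : ℝ) + 1) * (density d x • (w x * hermiteMulti (raise i k) x))))
      simpa using this
  -- The weak gradient identity for `φ m` says that the two convergent sequences are opposite to
  -- each other.
  have h3 := tendsto_nhds_unique lim2
    (lim1.neg.congr fun m => (h.integral_eq (φ m) (hφ m) (hφs m) i).symm)
  rw [integral_gaussian, integral_gaussian, ← integral_const_mul, ← neg_inj, ← h3, integral_neg]

/-- The classical gradient. -/
def grad (w : Space d → ℝ) (x : Space d) : Space d :=
  WithLp.toLp 2 fun i => fderiv ℝ w x (EuclideanSpace.single i 1)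

theorem continuous_fderiv_single {w : Space d → ℝ} (hw : ContDiff ℝ ∞ w) (i : Fin d) :
    Continuous fun x => fderiv ℝ w x (EuclideanSpace.single i 1) :=
  (hw.continuous_fderiv (by simp)).clm_apply continuous_const

theorem continuous_grad {w : Space d → ℝ} (hw : ContDiff ℝ ∞ w) : Continuous (grad w) :=
  (PiLp.continuous_toLp 2 _).comp (continuous_pi fun i => continuous_fderiv_single hw i)

theorem hasWeakGradient_grad {w : Space d → ℝ} (hw : ContDiff ℝ ∞ w) :
    HasWeakGradient w (grad w) where
  locallyIntegrable := hw.continuous.locallyIntegrable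
  locallyIntegrable_grad := (continuous_grad hw).locallyIntegrable
  integral_eq := by
    intro φ hφ hφs i
    simp only [grad]
    have hφ' := continuous_fderiv_single hφ i
    have hw' := continuous_fderiv_single hw i
    refine integral_mul_fderiv_eq_neg_fderiv_mul_of_integrable ?_ ?_ ?_
      (fun x _ => hw.differentiable (by simp) x) (fun x _ => hφ.differentiable (by simp) x)
    · exact (hw'.mul hφ.continuous).integrable_of_hasCompactSupport hφs.mul_left
    · exact (hw.continuous.mul hφ').integrable_of_hasCompactSupport
        (hφs.fderiv_apply (𝕜 := ℝ) _).mul_left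
    · exact (hw.continuous.mul hφ.continuous).integrable_of_hasCompactSupport hφs.mul_left

/-- The smooth case, with the derivative replaced by an explicit formula `w'` so that growth is
checked on that formula. It is the recursion behind orthonormality and the vanishing of low modes.
-/
theorem integral_fderiv_mul_hermiteMulti {w : Space d → ℝ} (hw : ContDiff ℝ ∞ w)
    (hw2 : ExpGrowth w) {i : Fin d} {w' : Space d → ℝ}
    (hw' : ∀ x, fderiv ℝ w x (EuclideanSpace.single i 1) = w' x) (hw'2 : ExpGrowth w')
    (k : Fin d → ℕ) :
    ∫ x, w' x * hermiteMulti k x ∂(gaussian d) =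
      √((k i : ℝ) + 1) * ∫ x, w x * hermiteMulti (raise i k) x ∂(gaussian d) := by
  have h : ∀ x, grad w x i = w' x := hw'
  rw [← integral_weakGradient_mul_hermiteMulti (hasWeakGradient_grad hw) hw2.memLp
    (by simpa only [h] using hw'2.memLp)]
  simp only [h]

end

section

variable {d : ℕ}

open Filter Topology

/-! ### Multi-indices -/

theorem raise_lower {i : Fin d} {k : Fin d → ℕ} (h : k i ≠ 0) : raise i (lower i k) = k := by
  ext j
  rcases eq_or_ne j i with rfl | hj
  · simp only [raise, lower, Function.update_self]
    omega
  · simp [raise, lower, hj]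

theorem lower_raise (i : Fin d) (k : Fin d → ℕ) : lower i (raise i k) = k := by
  ext j
  rcases eq_or_ne j i with rfl | hj
  · simp [raise, lower]
  · simp [raise, lower, hj]

theorem raise_injective (i : Fin d) : Function.Injective (raise i) :=
  Function.LeftInverse.injective (lower_raise i)

theorem raise_apply_self (i : Fin d) (k : Fin d → ℕ) : raise i k i = k i + 1 := by simp [raise]

theorem sum_raise (i : Fin d) (k : Fin d → ℕ) : ∑ j, raise i k j = (∑ j, k j) + 1 := by
  rw [raise, Finset.sum_update_of_mem (Finset.mem_univ i),
    ← Finset.add_sum_erase _ _ (Finset.mem_univ i), Finset.sdiff_singleton_eq_erase]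
  ring

theorem exists_eq_raise {k : Fin d → ℕ} (hk : k ≠ 0) : ∃ i l, k = raise i l := by
  obtain ⟨i, hi⟩ := Function.ne_iff.1 hk
  exact ⟨i, lower i k, (raise_lower hi).symm⟩

theorem multiIndex_induction {P : (Fin d → ℕ) → Prop} (zero : P 0)
    (step : ∀ i k, P k → P (raise i k)) (k : Fin d → ℕ) : P k := by
  obtain ⟨n, hn⟩ : ∃ n, ∑ j, k j = n := ⟨_, rfl⟩
  induction n generalizing k with
  | zero =>
    have : k = 0 := by
      ext j
      simpa using (Finset.sum_eq_zero_iff.1 hn) j (Finset.mem_univ j)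
    exact this ▸ zero
  | succ n ih =>
    have hk : k ≠ 0 := by
      rintro rfl
      simp at hn
    obtain ⟨i, l, rfl⟩ := exists_eq_raise hk
    rw [sum_raise] at hn
    exact step i l (ih l (by omega))

/-! ### Hermite polynomials as a Hilbert basis -/

theorem integral_hermiteMulti {k : Fin d → ℕ} (hk : k ≠ 0) :
    ∫ x, hermiteMulti k x ∂(gaussian d) = 0 := by
  obtain ⟨i, l, rfl⟩ := exists_eq_raise hk
  have h := integral_fderiv_mul_hermiteMulti (w := fun _ : Space d => (1 : ℝ)) contDiff_const
    (expGrowth_const 1) (i := i) (w' := fun _ => 0) (by simp) (expGrowth_const 0) l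
  have hp : √((l i : ℝ) + 1) ≠ 0 := by positivity
  simpa [hp] using h.symm

/-- Induction on `k`: integration by parts moves the raising operator from `H_{k+e_i}` to a
derivative, hence a lowering, of `H_l`. -/
theorem integral_hermiteMulti_mul_hermiteMulti (l k : Fin d → ℕ) :
    ∫ x, hermiteMulti l x * hermiteMulti k x ∂(gaussian d) = if l = k then 1 else 0 := by
  induction k using multiIndex_induction generalizing l with
  | zero =>
    simp only [hermiteMulti_zero, mul_one]
    split_ifs with h
    · simp [h, hermiteMulti_zero]
    · exact integral_hermiteMulti h
  | step i k ih =>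
    have h := integral_fderiv_mul_hermiteMulti (contDiff_hermiteMulti l)
      (expGrowth_hermiteMulti l) (i := i) (fun x => fderiv_hermiteMulti l i x)
      ((expGrowth_const _).mul (expGrowth_hermiteMulti _)) k
    simp only [mul_assoc, integral_const_mul, ih] at h
    have hp : √((k i : ℝ) + 1) ≠ 0 := by positivity
    split_ifs with hl
    · subst hl
      rw [lower_raise, if_pos rfl, raise_apply_self, Nat.cast_add, Nat.cast_one] at h
      exact (mul_left_cancel₀ hp h).symm
    -- If `l i = 0`, then `lower i l` is `l` itself and could equal `k`, but its coefficient `√(l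
    -- i)` vanishes.
    · rcases eq_or_ne (l i) 0 with h0 | h0
      · simpa [h0, hp] using h.symm
      · have : lower i l ≠ k := by
          rintro rfl
          exact hl (raise_lower h0).symm
        simpa [this, hp] using h.symm

/-! ### Totality of the Hermite polynomials and Parseval's identity -/

theorem coord_mul_hermiteMulti (k : Fin d → ℕ) (i : Fin d) (x : Space d) :
    x i * hermiteMulti k x = √((k i : ℝ) + 1) * hermiteMulti (raise i k) x +
      √(k i : ℝ) * hermiteMulti (lower i k) x := by
  rw [hermiteMulti_raise]
  ring

theorem expGrowth_inner (t : Space d) : ExpGrowth fun x : Space d => inner ℝ t x := by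
  refine ⟨by fun_prop, ‖t‖, 1, fun x => (abs_real_inner_le_norm t x).trans ?_⟩
  rw [one_mul]
  gcongr
  linarith [Real.add_one_le_exp ‖x‖]

theorem ExpGrowth.pow {f : Space d → ℝ} (hf : ExpGrowth f) (m : ℕ) :
    ExpGrowth fun x => f x ^ m := by
  simpa using expGrowth_prod (Finset.range m) (f := fun _ => f) fun _ _ => hf

/-- Multiplication by a coordinate maps each `H_k` into the span of the Hermite polynomials. Keeping
a general `H_k` beside the power closes the induction on `m`. -/
theorem integral_mul_inner_pow_mul_hermiteMulti {f : Space d → ℝ} (hf : MemLp f 2 (gaussian d))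
    (h : ∀ k, ∫ x, f x * hermiteMulti k x ∂(gaussian d) = 0) (t : Space d) (m : ℕ)
    (k : Fin d → ℕ) :
    ∫ x, f x * (inner ℝ t x ^ m * hermiteMulti k x) ∂(gaussian d) = 0 := by
  induction m generalizing k with
  | zero => simpa using h k
  | succ m ih =>
    have hi : ∀ l, Integrable (fun x => f x * (inner ℝ t x ^ m * hermiteMulti l x))
        (gaussian d) := fun l =>
      hf.integrable_mul (((expGrowth_inner t).pow m).mul (expGrowth_hermiteMulti l)).memLp
    have heq : ∀ x : Space d, f x * (inner ℝ t x ^ (m + 1) * hermiteMulti k x) =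
        ∑ i, (t i * √((k i : ℝ) + 1) * (f x * (inner ℝ t x ^ m * hermiteMulti (raise i k) x)) +
          t i * √(k i : ℝ) * (f x * (inner ℝ t x ^ m * hermiteMulti (lower i k) x))) := by
      intro x
      have h1 : f x * (inner ℝ t x ^ (m + 1) * hermiteMulti k x) =
          f x * inner ℝ t x ^ m * ∑ i, t i * (x i * hermiteMulti k x) := by
        rw [pow_succ, PiLp.inner_apply t x]
        simp only [← mul_assoc, ← Finset.sum_mul]
        simp [mul_comm, mul_left_comm]
      rw [h1, Finset.mul_sum]
      refine Finset.sum_congr rfl fun i _ => ?_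
      rw [coord_mul_hermiteMulti]
      ring
    simp only [heq]
    rw [integral_finsetSum]
    swap
    · exact fun i _ => ((hi _).const_mul _).add ((hi _).const_mul _)
    refine Finset.sum_eq_zero fun i _ => ?_
    rw [integral_add ((hi _).const_mul _) ((hi _).const_mul _), integral_const_mul,
      integral_const_mul, ih, ih]
    simp

/-- The exponential is expanded in its power series, each term of which integrates to 0. The partial
sums are dominated by `|f| exp (‖t‖ ‖x‖)`, a product of two `L²` functions. -/
theorem integral_smul_cexp_inner_eq_zero {f : Space d → ℝ} (hf : MemLp f 2 (gaussian d))
    (h : ∀ k, ∫ x, f x * hermiteMulti k x ∂(gaussian d) = 0) (t : Space d) :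
    ∫ x, f x • Complex.exp (inner ℝ x t * Complex.I) ∂(gaussian d) = 0 := by
  have hb : ∀ x : Space d, HasSum (fun m : ℕ => |f x| * ((‖t‖ * ‖x‖) ^ m / (m.factorial : ℝ)))
      (|f x| * Real.exp (‖t‖ * ‖x‖)) := fun x => by
    rw [Real.exp_eq_exp_ℝ]
    exact (NormedSpace.expSeries_div_hasSum_exp (‖t‖ * ‖x‖)).mul_left _
  have hs := hasSum_integral_of_dominated_convergence (μ := gaussian d)
    (F := fun (m : ℕ) x => f x • ((inner ℝ x t * Complex.I) ^ m / (m.factorial : ℂ)))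
    (f := fun x => f x • Complex.exp (inner ℝ x t * Complex.I))
    (fun m x => |f x| * ((‖t‖ * ‖x‖) ^ m / (m.factorial : ℝ)))
    (fun m => hf.1.smul (Continuous.aestronglyMeasurable (by fun_prop)))
    (fun m => Eventually.of_forall fun x => ?_)
    (Eventually.of_forall fun x => (hb x).summable) ?_
    (Eventually.of_forall fun x => ?_)
  · refine hs.unique ?_
    convert! (hasSum_zero : HasSum (fun _ : ℕ => (0 : ℂ)) 0) with m
    have h0 := integral_mul_inner_pow_mul_hermiteMulti hf h t m 0
    simp only [hermiteMulti_zero, mul_one] at h0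
    have heq : ∀ x : Space d, f x • ((inner ℝ x t * Complex.I) ^ m / (m.factorial : ℂ)) =
        ((f x * inner ℝ t x ^ m : ℝ) : ℂ) * (Complex.I ^ m / (m.factorial : ℂ)) := by
      intro x
      rw [real_inner_comm, Complex.real_smul, mul_pow]
      push_cast
      ring
    simp only [heq]
    rw [integral_mul_const, integral_complex_ofReal, h0]
    simp
  · rw [norm_smul, norm_div, norm_pow, norm_mul, Complex.norm_I, mul_one, Complex.norm_natCast,
      Complex.norm_real, Real.norm_eq_abs, Real.norm_eq_abs]
    gcongr
    rw [mul_comm ‖t‖]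
    exact abs_real_inner_le_norm x t
  · simp only [fun x => (hb x).tsum_eq]
    have : ExpGrowth fun x : Space d => Real.exp (‖t‖ * ‖x‖) :=
      ⟨by fun_prop, 1, ‖t‖, fun x => by simp⟩
    exact hf.norm.integrable_mul this.memLp
  · rw [Complex.exp_eq_exp_ℂ]
    exact (NormedSpace.expSeries_div_hasSum_exp _).const_smul _

/-- Hermite polynomials are total in `L²(μ)`. -/
theorem ae_eq_zero_of_integral_mul_hermiteMulti {f : Space d → ℝ} (hf : MemLp f 2 (gaussian d))
    (h : ∀ k, ∫ x, f x * hermiteMulti k x ∂(gaussian d) = 0) : f =ᵐ[gaussian d] 0 := by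
  have hfi : Integrable f (gaussian d) := hf.integrable one_le_two
  have : IsFiniteMeasure ((gaussian d).withDensity fun x => ENNReal.ofReal (f x)) :=
    isFiniteMeasure_withDensity_ofReal hfi.2
  have : IsFiniteMeasure ((gaussian d).withDensity fun x => ENNReal.ofReal (-f x)) :=
    isFiniteMeasure_withDensity_ofReal hfi.neg.2
  have hm : AEMeasurable (fun x => ENNReal.ofReal (f x)) (gaussian d) :=
    hf.1.aemeasurable.ennreal_ofReal
  have hm' : AEMeasurable (fun x => ENNReal.ofReal (-f x)) (gaussian d) :=
    hf.1.aemeasurable.neg.ennreal_ofReal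
  have hE : ∀ {u : Space d → ℝ} (t : Space d), Integrable u (gaussian d) →
      Integrable (fun x => u x • Complex.exp (inner ℝ x t * Complex.I)) (gaussian d) := by
    intro u t hu
    refine hu.norm.mono' (hu.1.smul (Continuous.aestronglyMeasurable (by fun_prop)))
      (Eventually.of_forall fun x => ?_)
    rw [norm_smul, Complex.norm_exp_ofReal_mul_I, mul_one]
  -- The positive and negative parts of `f` define finite measures with equal characteristic
  -- functions, hence equal measures.
  have key : ((gaussian d).withDensity fun x => ENNReal.ofReal (f x)) =
      (gaussian d).withDensity fun x => ENNReal.ofReal (-f x) := by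
    refine Measure.ext_of_charFun (funext fun t => ?_)
    rw [charFun_apply, charFun_apply,
      integral_withDensity_eq_integral_toReal_smul₀ hm (by simp),
      integral_withDensity_eq_integral_toReal_smul₀ hm' (by simp), ← sub_eq_zero,
      ← integral_sub]
    · rw [← integral_smul_cexp_inner_eq_zero hf h t]
      refine integral_congr_ae (Eventually.of_forall fun x => ?_)
      simp only [ENNReal.toReal_ofReal', ← sub_smul]
      congr 1
      exact max_zero_sub_eq_self (f x)
    · simp only [ENNReal.toReal_ofReal']
      exact hE t hfi.pos_part
    · simp only [ENNReal.toReal_ofReal']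
      exact hE t hfi.neg_part
  have h2 := (withDensity_eq_iff hm hm' hfi.lintegral_lt_top.ne).1 key
  filter_upwards [h2] with x hx
  rcases le_total 0 (f x) with h0 | h0
  · rw [ENNReal.ofReal_of_nonpos (neg_nonpos.2 h0), ENNReal.ofReal_eq_zero] at hx
    exact le_antisymm hx h0
  · rw [ENNReal.ofReal_of_nonpos h0, eq_comm, ENNReal.ofReal_eq_zero] at hx
    exact le_antisymm h0 (neg_nonpos.1 hx)

theorem inner_toLp_toLp {f g : Space d → ℝ} (hf : MemLp f 2 (gaussian d))
    (hg : MemLp g 2 (gaussian d)) :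
    inner ℝ (hf.toLp f) (hg.toLp g) = ∫ x, f x * g x ∂(gaussian d) := by
  rw [L2.inner_def]
  refine integral_congr_ae ?_
  filter_upwards [hf.coeFn_toLp, hg.coeFn_toLp] with x h1 h2
  simp [h1, h2, mul_comm]

/-- The Hermite polynomials as elements of `L²(μ)`. -/
def hermiteLp (k : Fin d → ℕ) : Lp ℝ 2 (gaussian d) :=
  (expGrowth_hermiteMulti k).memLp.toLp (hermiteMulti k)

theorem orthonormal_hermiteLp : Orthonormal ℝ (hermiteLp (d := d)) := by
  classical
  rw [orthonormal_iff_ite]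
  intro k l
  rw [hermiteLp, hermiteLp, inner_toLp_toLp, integral_hermiteMulti_mul_hermiteMulti]

theorem span_hermiteLp_orthogonal :
    (Submodule.span ℝ (Set.range (hermiteLp (d := d))))ᗮ = ⊥ := by
  rw [Submodule.eq_bot_iff]
  intro f hf
  have hfm := Lp.memLp f
  have h0 : f = hfm.toLp f := (Lp.toLp_coeFn f hfm).symm
  have h : f =ᵐ[gaussian d] 0 := by
    refine ae_eq_zero_of_integral_mul_hermiteMulti hfm fun k => ?_
    rw [← inner_toLp_toLp hfm (expGrowth_hermiteMulti k).memLp, ← h0]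
    exact (Submodule.mem_orthogonal' _ _).1 hf _ (Submodule.subset_span ⟨k, rfl⟩)
  exact (Lp.eq_zero_iff_ae_eq_zero).2 h

/-- Parseval's identity for the Hermite expansion. -/
theorem hasSum_sq_integral_mul_hermiteMulti {f : Space d → ℝ} (hf : MemLp f 2 (gaussian d)) :
    HasSum (fun k => (∫ x, f x * hermiteMulti k x ∂(gaussian d)) ^ 2)
      (∫ x, f x ^ 2 ∂(gaussian d)) := by
  have h := (HilbertBasis.mkOfOrthogonalEqBot orthonormal_hermiteLp
    span_hermiteLp_orthogonal).hasSum_inner_mul_inner (hf.toLp f) (hf.toLp f)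
  simp only [HilbertBasis.coe_mkOfOrthogonalEqBot] at h
  simp only [real_inner_comm (hf.toLp f), ← sq] at h
  simpa only [hermiteLp, inner_toLp_toLp, ← sq] using h

end

section

variable {d : ℕ}

open Filter Topology

/-! ### The Poincaré inequality for functions without low Hermite modes -/

theorem hasSum_mul_sq_integral_mul_hermiteMulti {w : Space d → ℝ} {g : Space d → Space d}
    (h : HasWeakGradient w g) (hw : MemLp w 2 (gaussian d)) {i : Fin d}
    (hg : MemLp (fun x => g x i) 2 (gaussian d)) :
    HasSum (fun k : Fin d → ℕ => (k i : ℝ) * (∫ x, w x * hermiteMulti k x ∂(gaussian d)) ^ 2)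
      (∫ x, g x i ^ 2 ∂(gaussian d)) := by
  -- Parseval for `∂_i w`, reindexed by `k ↦ k + e_i`. The indices missed have `k i = 0`, so their
  -- weight is 0.
  rw [← (raise_injective i).hasSum_iff]
  · convert! hasSum_sq_integral_mul_hermiteMulti hg using 1
    ext k
    rw [integral_weakGradient_mul_hermiteMulti h hw hg, mul_pow, Real.sq_sqrt (by positivity)]
    simp [raise_apply_self]
  · intro k hk
    have : k i = 0 := by
      by_contra h0
      exact hk ⟨lower i k, raise_lower h0⟩
    simp [this]

theorem mul_integral_sq_sub_one_le {n : ℕ} {w : Space d → ℝ} {g : Space d → Space d}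
    (h : HasWeakGradient w g) (hw : MemLp w 2 (gaussian d)) (hg : MemLp g 2 (gaussian d))
    (h1 : ∫ x, w x ∂(gaussian d) = 1)
    (hH : ∀ k : Fin d → ℕ, 0 < ∑ j, k j → ∑ j, k j < n →
      ∫ x, w x * hermiteMulti k x ∂(gaussian d) = 0) :
    n * (∫ x, w x ^ 2 ∂(gaussian d) - 1) ≤ ∫ x, ‖g x‖ ^ 2 ∂(gaussian d) := by
  classical
  have hgi : ∀ i, MemLp (fun x => g x i) 2 (gaussian d) := fun i => by
    refine hg.mono ?_ (Eventually.of_forall fun x => PiLp.norm_apply_le (g x) i)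
    exact (EuclideanSpace.proj (𝕜 := ℝ) i).continuous.comp_aestronglyMeasurable hg.1
  have hs := hasSum_sum (s := Finset.univ) fun i _ =>
    hasSum_mul_sq_integral_mul_hermiteMulti h hw (hgi i)
  have hnorm : ∫ x, ‖g x‖ ^ 2 ∂(gaussian d) = ∑ i, ∫ x, g x i ^ 2 ∂(gaussian d) := by
    rw [← integral_finsetSum _ fun i _ => (hgi i).integrable_sq]
    simp [EuclideanSpace.norm_sq_eq]
  rw [hnorm]
  -- Termwise comparison of `n (c_k² - δ_{k0})` with `|k| c_k²`: at `k = 0` both sides vanish as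
  -- `c_0 = 1`, and for `0 < |k| < n` the coefficient vanishes.
  refine hasSum_le (fun k => ?_) (((hasSum_sq_integral_mul_hermiteMulti hw).sub
    (hasSum_ite_eq (0 : Fin d → ℕ) (1 : ℝ))).mul_left (n : ℝ)) hs
  rw [← Finset.sum_mul]
  rcases eq_or_ne k 0 with rfl | hk
  · simp [hermiteMulti_zero, h1]
  · have hpos : 0 < ∑ j, k j := by
      obtain ⟨i, l, rfl⟩ := exists_eq_raise hk
      rw [sum_raise]
      omega
    rw [if_neg hk, sub_zero]
    rcases lt_or_ge (∑ j, k j) n with hlt | hge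
    · simp [hH k hpos hlt]
    · refine mul_le_mul_of_nonneg_right ?_ (sq_nonneg _)
      exact_mod_cast hge

/-! ### The improved logarithmic Sobolev inequality -/

theorem ae_abs_le_of_memLp_top {w : Space d → ℝ} (hw : MemLp w ∞ volume) :
    ∀ᵐ x, |w x| ≤ (eLpNorm w ∞ volume).toReal := by
  have h := hw.2.ne
  rw [eLpNorm_exponent_top] at h ⊢
  filter_upwards [ae_le_eLpNormEssSup (f := w) (μ := volume)] with x hx
  rw [← Real.norm_eq_abs, ← toReal_enorm]
  exact ENNReal.toReal_mono h hx

namespace Admissible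

variable {n : ℕ} {w : Space d → ℝ}

theorem aestronglyMeasurable (h : Admissible n w) : AEStronglyMeasurable w (gaussian d) :=
  h.memLp_top.1.mono_ac gaussian_absolutelyContinuous

theorem memLp (h : Admissible n w) (p : ℝ≥0∞) : MemLp w p (gaussian d) :=
  MemLp.of_bound h.aestronglyMeasurable _
    (gaussian_absolutelyContinuous.ae_le (ae_abs_le_of_memLp_top h.memLp_top))

theorem one_le_norm (h : Admissible n w) : 1 ≤ (eLpNorm w ∞ volume).toReal := by
  rw [← h.integral_eq_one]
  calc ∫ x, w x ∂(gaussian d) ≤ ∫ x, (eLpNorm w ∞ volume).toReal ∂(gaussian d) := by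
        refine integral_mono_ae ((h.memLp 1).integrable le_rfl) (integrable_const _) ?_
        filter_upwards [gaussian_absolutelyContinuous.ae_le
          (ae_abs_le_of_memLp_top h.memLp_top)] with x hx
        exact (le_abs_self _).trans hx
    _ = _ := by simp

/-- The essential infimum of a real function is meaningful only under bounds on both sides; this
lemma and the next provide them. -/
theorem isBoundedUnder_ge (h : Admissible n w) : IsBoundedUnder (· ≥ ·) (ae volume) w :=
  ⟨0, h.nonneg⟩

theorem isCoboundedUnder_ge (h : Admissible n w) : IsCoboundedUnder (· ≥ ·) (ae volume) w := by
  refine IsBoundedUnder.isCoboundedUnder_ge ⟨(eLpNorm w ∞ volume).toReal, ?_⟩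
  rw [eventually_map]
  filter_upwards [ae_abs_le_of_memLp_top h.memLp_top] with x hx
  exact (le_abs_self _).trans hx

theorem essInf_nonneg (h : Admissible n w) : 0 ≤ essInf w volume :=
  le_essInf_of_ae_le 0 h.nonneg h.isCoboundedUnder_ge

theorem H1_pos (h : Admissible n w) : 0 < H1 w :=
  mul_pos (zero_lt_one.trans_le h.one_le_norm) (h1_pos h.essInf_nonneg)

theorem integrable_mul_log (h : Admissible n w) :
    Integrable (fun x => w x * Real.log (w x)) (gaussian d) := by
  obtain ⟨C, hC⟩ := (isCompact_Icc (a := -(eLpNorm w ∞ volume).toReal)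
    (b := (eLpNorm w ∞ volume).toReal)).exists_bound_of_continuousOn
    Real.continuous_mul_log.continuousOn
  refine Integrable.of_bound (Real.continuous_mul_log.comp_aestronglyMeasurable
    h.aestronglyMeasurable) C ?_
  filter_upwards [gaussian_absolutelyContinuous.ae_le
    (ae_abs_le_of_memLp_top h.memLp_top)] with x hx
  exact hC _ (abs_le.1 hx)

theorem integral_sub_one_sq (h : Admissible n w) :
    ∫ x, (w x - 1) ^ 2 ∂(gaussian d) = ∫ x, w x ^ 2 ∂(gaussian d) - 1 := by
  have hi := (h.memLp 1).integrable le_rfl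
  have h2 : ∀ x, (w x - 1) ^ 2 = w x ^ 2 - (2 * w x - 1) := fun x => by ring
  simp only [h2]
  rw [integral_sub (g := fun x => 2 * w x - 1) (h.memLp 2).integrable_sq
    ((hi.const_mul 2).sub (integrable_const 1)), integral_sub (hi.const_mul 2) (integrable_const 1), integral_const_mul, h.integral_eq_one]
  simp
  norm_num

theorem integrable_sub_one_sq (h : Admissible n w) :
    Integrable (fun x => (w x - 1) ^ 2) (gaussian d) :=
  ((h.memLp 2).sub (memLp_const 1)).integrable_sq

theorem integral_sub_one_add (h : Admissible n w) (c : ℝ) :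
    ∫ x, ((w x - 1) + c * (w x - 1) ^ 2) ∂(gaussian d) =
      c * (∫ x, w x ^ 2 ∂(gaussian d) - 1) := by
  have hi := (h.memLp 1).integrable le_rfl
  rw [integral_add (f := fun x => w x - 1) (hi.sub (integrable_const 1)) (h.integrable_sub_one_sq.const_mul c),
    integral_const_mul, h.integral_sub_one_sq, integral_sub hi (integrable_const 1),
    h.integral_eq_one]
  simp

theorem integrable_sub_one_add (h : Admissible n w) (c : ℝ) :
    Integrable (fun x => (w x - 1) + c * (w x - 1) ^ 2) (gaussian d) :=
  (((h.memLp 1).integrable le_rfl).sub (integrable_const 1)).add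
    (h.integrable_sub_one_sq.const_mul c)

/-- Since `w ≥ inf w` almost everywhere, monotonicity of `h1` bounds the Taylor remainder pointwise;
the linear term has integral 0. -/
theorem entropy_le (h : Admissible n w) :
    entropy w ≤ h1 (essInf w volume) * (∫ x, w x ^ 2 ∂(gaussian d) - 1) := by
  rw [← h.integral_sub_one_add]
  refine integral_mono_ae h.integrable_mul_log (h.integrable_sub_one_add _) ?_
  filter_upwards [gaussian_absolutelyContinuous.ae_le
    (ae_essInf_le h.isBoundedUnder_ge)] with x hx
  rw [mul_log_eq_add_h1_mul_sq]
  gcongr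
  exact h1_antitoneOn h.essInf_nonneg (h.essInf_nonneg.trans hx) hx

theorem le_entropy (h : Admissible n w) {M : ℝ} (hM : ∀ x, w x ≤ M) (hw : ∀ x, 0 ≤ w x) :
    h1 M * (∫ x, w x ^ 2 ∂(gaussian d) - 1) ≤ entropy w := by
  rw [← h.integral_sub_one_add]
  refine integral_mono (h.integrable_sub_one_add _) h.integrable_mul_log fun x => ?_
  simp only [mul_log_eq_add_h1_mul_sq (w x)]
  gcongr
  exact h1_antitoneOn (hw x) ((hw x).trans (hM x)) (hM x)

theorem ofReal_entropy_le (h : Admissible n w) (hn : 1 ≤ n) :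
    ENNReal.ofReal (entropy w) ≤ ENNReal.ofReal (H1 w / n) * fisher w := by
  have hn0 : (0 : ℝ) < n := by exact_mod_cast hn
  have hc : 0 < H1 w / n := div_pos h.H1_pos hn0
  have hc0 : ENNReal.ofReal (H1 w / n) ≠ 0 := by simpa using hc
  -- A positive finite constant passes inside the infimum, also when there is no weak gradient and
  -- the infimum is `∞`.
  simp only [fisher, ENNReal.mul_iInf_of_ne hc0 ENNReal.ofReal_ne_top]
  refine le_iInf₂ fun g hg => ?_
  rcases eq_or_ne (∫⁻ x, ‖g x‖ₑ ^ 2 / ENNReal.ofReal (w x) ∂(gaussian d)) ⊤ with hI | hI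
  · rw [hI, ENNReal.mul_top hc0]
    exact le_top
  set M := (eLpNorm w ∞ volume).toReal with hMdef
  have hM : 0 < M := zero_lt_one.trans_le h.one_le_norm
  have hM0 : ENNReal.ofReal M ≠ 0 := by simpa using hM
  -- Division in `[0, ∞]` is antitone in the denominator, so zeros of `w` need no separate
  -- treatment.
  have hle : ∫⁻ x, ‖g x‖ₑ ^ 2 ∂(gaussian d) ≤
      ENNReal.ofReal M * ∫⁻ x, ‖g x‖ₑ ^ 2 / ENNReal.ofReal (w x) ∂(gaussian d) := by
    rw [← lintegral_const_mul' _ _ ENNReal.ofReal_ne_top]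
    refine lintegral_mono_ae ?_
    filter_upwards [gaussian_absolutelyContinuous.ae_le
      (ae_abs_le_of_memLp_top h.memLp_top)] with x hx
    calc ‖g x‖ₑ ^ 2 = ENNReal.ofReal M * (‖g x‖ₑ ^ 2 / ENNReal.ofReal M) :=
          (ENNReal.mul_div_cancel hM0 ENNReal.ofReal_ne_top).symm
      _ ≤ _ := by
          gcongr
          exact (le_abs_self _).trans hx
  have hfin : ENNReal.ofReal M * ∫⁻ x, ‖g x‖ₑ ^ 2 / ENNReal.ofReal (w x) ∂(gaussian d) ≠ ⊤ :=
    ENNReal.mul_ne_top ENNReal.ofReal_ne_top hI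
  have hgm : AEStronglyMeasurable g (gaussian d) :=
    hg.locallyIntegrable_grad.aestronglyMeasurable.mono_ac gaussian_absolutelyContinuous
  have hsq : ∀ x, ENNReal.ofReal (‖g x‖ ^ 2) = ‖g x‖ₑ ^ 2 := fun x => by
    rw [ENNReal.ofReal_pow (norm_nonneg _), ofReal_norm]
  -- Finite Fisher information and bounded `w` put the gradient in `L²(μ)`, as the Hermite expansion
  -- requires.
  have hg2 : MemLp g 2 (gaussian d) := by
    rw [memLp_two_iff_integrable_sq_norm hgm]
    refine ⟨(hgm.norm.pow 2), ?_⟩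
    rw [hasFiniteIntegral_iff_ofReal (Eventually.of_forall fun x => by positivity)]
    simp only [hsq]
    exact hle.trans_lt hfin.lt_top
  have hint : ∫ x, ‖g x‖ ^ 2 ∂(gaussian d) ≤
      M * (∫⁻ x, ‖g x‖ₑ ^ 2 / ENNReal.ofReal (w x) ∂(gaussian d)).toReal := by
    rw [integral_eq_lintegral_of_nonneg_ae (f := fun x => ‖g x‖ ^ 2) (Eventually.of_forall fun x => by positivity)
      (hgm.norm.pow 2)]
    simp only [hsq]
    refine (ENNReal.toReal_mono hfin hle).trans ?_
    rw [ENNReal.toReal_mul, ENNReal.toReal_ofReal hM.le]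
  have hP := mul_integral_sq_sub_one_le hg (h.memLp 2) hg2 h.integral_eq_one h.integral_hermite
  have hE := h.entropy_le
  have hh := h1_pos h.essInf_nonneg
  have hfinal : entropy w ≤ H1 w / n *
      (∫⁻ x, ‖g x‖ₑ ^ 2 / ENNReal.ofReal (w x) ∂(gaussian d)).toReal := by
    refine hE.trans ?_
    rw [H1, ← hMdef, div_mul_eq_mul_div, le_div_iff₀ hn0, mul_comm M, mul_assoc, mul_assoc,
      mul_comm _ (n : ℝ)]
    exact mul_le_mul_of_nonneg_left (hP.trans hint) hh.le
  calc ENNReal.ofReal (entropy w) ≤ ENNReal.ofReal (H1 w / n *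
        (∫⁻ x, ‖g x‖ₑ ^ 2 / ENNReal.ofReal (w x) ∂(gaussian d)).toReal) :=
        ENNReal.ofReal_le_ofReal hfinal
    _ = _ := by rw [ENNReal.ofReal_mul hc.le, ENNReal.ofReal_toReal hI]

end Admissible

end

section

variable {d : ℕ}

open Filter Topology

/-! ### Trigonometric polynomials without low Hermite modes -/

/-- A trigonometric polynomial in the coordinate `x i₀`. -/
def trig (n : ℕ) (i₀ : Fin d) (t a : ℕ → ℝ) (θ : ℝ) (x : Space d) : ℝ :=
  ∑ j ∈ Finset.range (n + 1), a j * Real.cos (t j * x i₀ + θ)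

variable {n : ℕ} {i₀ : Fin d} {t a : ℕ → ℝ} {θ : ℝ}

theorem contDiff_trig : ContDiff ℝ ∞ (trig n i₀ t a θ) := by
  unfold trig
  fun_prop

theorem abs_trig_le (x : Space d) :
    |trig n i₀ t a θ x| ≤ ∑ j ∈ Finset.range (n + 1), |a j| := by
  refine (Finset.abs_sum_le_sum_abs _ _).trans (Finset.sum_le_sum fun j _ => ?_)
  rw [abs_mul]
  exact mul_le_of_le_one_right (abs_nonneg _) (Real.abs_cos_le_one _)

theorem expGrowth_trig : ExpGrowth (trig n i₀ t a θ) :=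
  expGrowth_of_bounded contDiff_trig.continuous abs_trig_le

/-- Because `cos' = cos (· + π/2)`, the phase `θ` keeps the family closed under differentiation:
amplitudes are multiplied by the frequencies and the phase shifts. -/
theorem fderiv_trig (i : Fin d) (x : Space d) :
    fderiv ℝ (trig n i₀ t a θ) x (EuclideanSpace.single i 1) =
      if i = i₀ then trig n i₀ t (fun j => a j * t j) (θ + Real.pi / 2) x else 0 := by
  rw [← (contDiff_trig.differentiable (by simp) x).lineDeriv_eq_fderiv]
  refine HasLineDerivAt.lineDeriv ?_
  unfold HasLineDerivAt
  split_ifs with h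
  · subst h
    simp only [trig]
    refine HasDerivAt.fun_sum fun j _ => ?_
    have h1 : HasDerivAt (fun s : ℝ => t j * (x + s • EuclideanSpace.single i (1 : ℝ)) i + θ)
        (t j) 0 := by
      simpa using ((((hasDerivAt_id (0 : ℝ)).const_add (x i)).const_mul (t j)).add_const θ)
    refine (h1.cos.const_mul (a j)).congr_deriv ?_
    rw [← add_assoc, Real.cos_add_pi_div_two]
    simp
    ring
  · have h1 : (fun s : ℝ => trig n i₀ t a θ (x + s • EuclideanSpace.single i (1 : ℝ))) =
        fun _ => trig n i₀ t a θ x := by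
      ext s
      simp [trig, Ne.symm h]
    rw [h1]
    exact hasDerivAt_const _ _

theorem integral_cos_coord (i : Fin d) (u θ : ℝ) :
    ∫ x : Space d, Real.cos (u * x i + θ) ∂(gaussian d) =
      Real.exp (-u ^ 2 / 2) * Real.cos θ := by
  have hre : ∀ x : Space d, Real.cos (u * x i + θ) = RCLike.re (Complex.exp (Complex.I *
      inner ℝ (EuclideanSpace.single i u) x) * Complex.exp (θ * Complex.I)) := by
    intro x
    rw [← Complex.exp_add, EuclideanSpace.inner_single_left, ← Complex.exp_ofReal_mul_I_re]
    simp only [RCLike.re_eq_complex_re, conj_trivial]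
    congr 2
    push_cast
    ring
  simp only [hre]
  rw [integral_re, integral_mul_const, integral_cexp_inner]
  · have h1 : Complex.exp (-‖(EuclideanSpace.single i u : Space d)‖ ^ 2 / 2) =
        ((Real.exp (-u ^ 2 / 2) : ℝ) : ℂ) := by
      rw [Complex.ofReal_exp]
      congr 1
      rw [PiLp.norm_single, ← Complex.ofReal_pow, Real.norm_eq_abs, sq_abs]
      push_cast
      ring
    rw [h1, RCLike.re_eq_complex_re, Complex.re_ofReal_mul, Complex.exp_ofReal_mul_I_re]
  · refine Integrable.mul_const ?_ _
    refine Integrable.of_bound (Continuous.aestronglyMeasurable (by fun_prop)) 1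
      (Eventually.of_forall fun x => ?_)
    rw [mul_comm, Complex.norm_exp_ofReal_mul_I]

theorem integral_trig :
    ∫ x, trig n i₀ t a θ x ∂(gaussian d) =
      (∑ j ∈ Finset.range (n + 1), a j * Real.exp (-t j ^ 2 / 2)) * Real.cos θ := by
  unfold trig
  rw [integral_finsetSum, Finset.sum_mul]
  · refine Finset.sum_congr rfl fun j _ => ?_
    rw [integral_const_mul, integral_cos_coord]
    ring
  · intro j _
    refine Integrable.const_mul ?_ _
    exact ((expGrowth_of_bounded (by fun_prop)
      fun x => Real.abs_cos_le_one (t j * x i₀ + θ)).memLp).integrable one_le_two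

/-- Each step of the induction trades a raised index for a derivative. In the direction `i₀` this
multiplies `a j` by `t j` and uses the moment condition one order higher; in other directions the
derivative is 0. -/
theorem integral_trig_mul_hermiteMulti (k : Fin d → ℕ)
    (h : ∀ m ≤ ∑ j, k j,
      ∑ j ∈ Finset.range (n + 1), a j * t j ^ m * Real.exp (-t j ^ 2 / 2) = 0) :
    ∫ x, trig n i₀ t a θ x * hermiteMulti k x ∂(gaussian d) = 0 := by
  induction k using multiIndex_induction generalizing a θ with
  | zero =>
    have h0 := h 0 (Nat.zero_le _)
    simp only [pow_zero, mul_one] at h0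
    simp only [hermiteMulti_zero, mul_one]
    rw [integral_trig, h0, zero_mul]
  | step i k ih =>
    have hp : √((k i : ℝ) + 1) ≠ 0 := by positivity
    rcases eq_or_ne i i₀ with rfl | hi
    · have h1 := integral_fderiv_mul_hermiteMulti contDiff_trig expGrowth_trig
        (fun x => (fderiv_trig (n := n) (i₀ := i) (t := t) (a := a) (θ := θ) i x).trans
          (if_pos rfl)) expGrowth_trig k
      rw [ih, eq_comm] at h1
      · exact (mul_eq_zero.1 h1).resolve_left hp
      · intro m hm
        rw [← h (m + 1) (by rw [sum_raise]; omega)]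
        refine Finset.sum_congr rfl fun j _ => ?_
        ring
    · have h1 := integral_fderiv_mul_hermiteMulti contDiff_trig expGrowth_trig
        (fun x => (fderiv_trig (n := n) (i₀ := i₀) (t := t) (a := a) (θ := θ) i x).trans
          (if_neg hi)) (expGrowth_const 0) k
      simpa [hp] using h1.symm

theorem integral_trig_sq :
    ∫ x, trig n i₀ t a θ x ^ 2 ∂(gaussian d) =
      ∑ j ∈ Finset.range (n + 1), ∑ l ∈ Finset.range (n + 1), a j * a l *
        ((Real.exp (-(t j - t l) ^ 2 / 2) + Real.exp (-(t j + t l) ^ 2 / 2) * Real.cos (2 * θ))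
          / 2) := by
  have hi : ∀ u θ : ℝ, Integrable (fun x : Space d => Real.cos (u * x i₀ + θ)) (gaussian d) :=
    fun u θ => ((expGrowth_of_bounded (by fun_prop)
      fun x => Real.abs_cos_le_one (u * x i₀ + θ)).memLp).integrable one_le_two
  have hint : ∀ j l, Integrable (fun x : Space d => a j * a l *
      ((Real.cos ((t j - t l) * x i₀ + 0) + Real.cos ((t j + t l) * x i₀ + 2 * θ)) / 2))
      (gaussian d) := fun j l => (((hi _ _).add (hi _ _)).div_const 2).const_mul _
  have heq : ∀ x : Space d, trig n i₀ t a θ x ^ 2 =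
      ∑ j ∈ Finset.range (n + 1), ∑ l ∈ Finset.range (n + 1), a j * a l *
        ((Real.cos ((t j - t l) * x i₀ + 0) + Real.cos ((t j + t l) * x i₀ + 2 * θ)) / 2) := by
    intro x
    rw [trig, sq, Finset.sum_mul_sum]
    refine Finset.sum_congr rfl fun j _ => Finset.sum_congr rfl fun l _ => ?_
    have h1 := Real.two_mul_cos_mul_cos (t j * x i₀ + θ) (t l * x i₀ + θ)
    rw [show (t j - t l) * x i₀ + 0 = t j * x i₀ + θ - (t l * x i₀ + θ) by ring,
      show (t j + t l) * x i₀ + 2 * θ = t j * x i₀ + θ + (t l * x i₀ + θ) by ring, ← h1]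
    ring
  simp only [heq]
  rw [integral_finsetSum _ fun j _ => integrable_finsetSum _ fun l _ => hint j l]
  refine Finset.sum_congr rfl fun j _ => ?_
  rw [integral_finsetSum _ fun l _ => hint j l]
  refine Finset.sum_congr rfl fun l _ => ?_
  rw [integral_const_mul, integral_div, integral_add (hi _ _) (hi _ _), integral_cos_coord,
    integral_cos_coord, Real.cos_zero, mul_one]

/-! ### Alternating sums of powers and a power series -/

/-- The coefficients of the `n`-th forward difference. -/
def altChoose (n j : ℕ) : ℝ := (-1) ^ (n - j) * n.choose j

theorem sum_altChoose_mul_pow (n m : ℕ) :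
    ∑ j ∈ Finset.range (n + 1), altChoose n j * (j : ℝ) ^ m =
      (fwdDiff (1 : ℝ))^[n] (fun r : ℝ => r ^ m) 0 := by
  rw [fwdDiff_iter_eq_sum_shift]
  refine Finset.sum_congr rfl fun j _ => ?_
  simp [altChoose]

theorem sum_altChoose_mul_pow_of_lt {n m : ℕ} (h : m < n) :
    ∑ j ∈ Finset.range (n + 1), altChoose n j * (j : ℝ) ^ m = 0 := by
  rw [sum_altChoose_mul_pow, fwdDiff_iter_pow_eq_zero_of_lt h]
  rfl

theorem sum_altChoose_mul_pow_self (n : ℕ) :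
    ∑ j ∈ Finset.range (n + 1), altChoose n j * (j : ℝ) ^ n = n.factorial := by
  rw [sum_altChoose_mul_pow, fwdDiff_iter_eq_factorial]
  simp

theorem hasSum_nat_mul_pow_div_factorial (y : ℝ) :
    HasSum (fun m : ℕ => (m : ℝ) * (y ^ m / (m.factorial : ℝ))) (y * Real.exp y) := by
  rw [← hasSum_nat_add_iff' 1]
  simp only [Finset.range_one, Finset.sum_singleton, Nat.cast_zero, zero_mul, sub_zero]
  rw [Real.exp_eq_exp_ℝ]
  convert! (NormedSpace.expSeries_div_hasSum_exp y).mul_left y using 1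
  ext m
  rw [Nat.factorial_succ]
  push_cast
  field_simp
  ring

/-- The coefficients of the power series in `s = τ²` of the norm of the extremal trigonometric
polynomial. -/
def sqCoeff (n m : ℕ) : ℝ :=
  (1 + (-1) ^ n * (-1) ^ m) / 2 *
    (∑ j ∈ Finset.range (n + 1), altChoose n j * (j : ℝ) ^ m) ^ 2 / (m.factorial : ℝ)

theorem sqCoeff_nonneg (n m : ℕ) : 0 ≤ sqCoeff n m := by
  have : 0 ≤ 1 + (-1 : ℝ) ^ n * (-1) ^ m := by
    rw [← pow_add]
    rcases neg_one_pow_eq_or ℝ (n + m) with h | h <;> rw [h] <;> norm_num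
  unfold sqCoeff
  positivity

theorem sqCoeff_self_pos (n : ℕ) : 0 < sqCoeff n n := by
  rw [sqCoeff, sum_altChoose_mul_pow_self, ← mul_pow]
  norm_num
  positivity

/-- Expanding the square in `sqCoeff` turns `j^m l^m s^m` into powers of `j l s`, and the sign
`(-1)^m` into the argument `-(j l s)`. The weight `φ = 1` gives the `L²` norm and `φ m = m` the
Dirichlet integral. -/
theorem hasSum_sqCoeff_of {φ : ℕ → ℝ} {u : ℝ → ℝ}
    (hu : ∀ y, HasSum (fun m => φ m * (y ^ m / (m.factorial : ℝ))) (u y)) (n : ℕ) (s : ℝ) :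
    HasSum (fun m => φ m * (sqCoeff n m * s ^ m))
      (∑ j ∈ Finset.range (n + 1), ∑ l ∈ Finset.range (n + 1), altChoose n j * altChoose n l *
        ((u (j * l * s) + (-1) ^ n * u (-(j * l * s))) / 2)) := by
  have h := hasSum_sum (s := Finset.range (n + 1)) fun j _ =>
    hasSum_sum (s := Finset.range (n + 1)) fun l _ =>
      (((hu (j * l * s)).add ((hu (-(j * l * s))).mul_left ((-1) ^ n))).div_const 2).mul_left
        (altChoose n j * altChoose n l)
  convert! h using 1
  ext m
  rw [sqCoeff, sq, Finset.sum_mul_sum]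
  simp only [Finset.mul_sum, Finset.sum_div, Finset.sum_mul]
  refine Finset.sum_congr rfl fun j _ => Finset.sum_congr rfl fun l _ => ?_
  rw [neg_pow, mul_pow, mul_pow]
  ring

theorem hasSum_sqCoeff (n : ℕ) (s : ℝ) :
    HasSum (fun m => sqCoeff n m * s ^ m)
      (∑ j ∈ Finset.range (n + 1), ∑ l ∈ Finset.range (n + 1), altChoose n j * altChoose n l *
        ((Real.exp (j * l * s) + (-1) ^ n * Real.exp (-(j * l * s))) / 2)) := by
  have h := hasSum_sqCoeff_of (φ := fun _ => 1) (u := Real.exp) (fun y => by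
    rw [Real.exp_eq_exp_ℝ]
    simpa using NormedSpace.expSeries_div_hasSum_exp y) n s
  simpa only [one_mul] using h

theorem hasSum_nat_mul_sqCoeff (n : ℕ) (s : ℝ) :
    HasSum (fun m : ℕ => (m : ℝ) * (sqCoeff n m * s ^ m))
      (∑ j ∈ Finset.range (n + 1), ∑ l ∈ Finset.range (n + 1), altChoose n j * altChoose n l *
        (j * l * s * (Real.exp (j * l * s) - (-1) ^ n * Real.exp (-(j * l * s))) / 2)) := by
  have h := hasSum_sqCoeff_of (φ := fun m => (m : ℝ)) (u := fun y => y * Real.exp y)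
    hasSum_nat_mul_pow_div_factorial n s
  convert! h using 1
  refine Finset.sum_congr rfl fun j _ => Finset.sum_congr rfl fun l _ => ?_
  ring

/-- Near `0`, the series `∑ A_m s^m` of order `n` dominates `c ∑ m A_m s^m` for `c < 1 / n`. -/
theorem exists_mul_lt_of_hasSum {A : ℕ → ℝ} {G D : ℝ → ℝ} (hA : ∀ m, 0 ≤ A m)
    (hn : 0 < A n) (hG : ∀ s, HasSum (fun m => A m * s ^ m) (G s))
    (hD : ∀ s, HasSum (fun m : ℕ => (m : ℝ) * (A m * s ^ m)) (D s)) {c : ℝ} (hc : 0 ≤ c)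
    (hcn : c * n < 1) : ∃ s, 0 < s ∧ c * D s < G s := by
  have hcn' : 0 < 1 - c * n := by linarith
  -- The slack `1 - c n` on the term `A n * s ^ n` has to absorb a tail of order `s ^ (n + 1)`.
  have hlim : ∀ᶠ s : ℝ in 𝓝[>] 0, c * s * D 1 < (1 - c * n) * A n := by
    refine nhdsWithin_le_nhds ?_
    have hcont : Continuous fun s : ℝ => c * s * D 1 := by fun_prop
    refine (hcont.tendsto 0).eventually_lt_const ?_
    simpa using mul_pos hcn' hn
  obtain ⟨s, hs, hs0, hs1⟩ := (hlim.and (Ioc_mem_nhdsGT (zero_lt_one (α := ℝ)))).exists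
  refine ⟨s, hs0, ?_⟩
  -- Terms with `m ≤ n` have weight at most `n`. For `m > n` and `s ≤ 1`, `s ^ m ≤ s ^ (n + 1)`, so
  -- the tail is controlled by the series at 1.
  have hle : D s ≤ n * G s + s ^ (n + 1) * D 1 := by
    refine hasSum_le (fun m => ?_) (hD s) (((hG s).mul_left (n : ℝ)).add
      ((hD 1).mul_left (s ^ (n + 1))))
    have h1 : 0 ≤ A m * s ^ m := mul_nonneg (hA m) (by positivity)
    have h2 : 0 ≤ s ^ (n + 1) * (m * (A m * 1 ^ m)) :=
      mul_nonneg (by positivity) (mul_nonneg (by positivity) (mul_nonneg (hA m) (by positivity)))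
    rcases le_or_gt m n with hm | hm
    · have : (m : ℝ) * (A m * s ^ m) ≤ n * (A m * s ^ m) := by gcongr
      linarith
    · have h3 : s ^ m ≤ s ^ (n + 1) := pow_le_pow_of_le_one hs0.le hs1 hm
      have h4 : (m : ℝ) * (A m * s ^ m) ≤ m * (A m * s ^ (n + 1)) :=
        mul_le_mul_of_nonneg_left (mul_le_mul_of_nonneg_left h3 (hA m)) (by positivity)
      have h5 : (0 : ℝ) ≤ n * (A m * s ^ m) := by positivity
      rw [one_pow]
      linarith
  have hge : A n * s ^ n ≤ G s := le_hasSum (hG s) n fun m _ => mul_nonneg (hA m) (by positivity)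
  have hsn : 0 < s ^ n := by positivity
  calc c * D s ≤ c * (n * G s + s ^ (n + 1) * D 1) := by gcongr
    _ = c * n * G s + c * s * D 1 * s ^ n := by ring
    _ < c * n * G s + (1 - c * n) * A n * s ^ n := by gcongr
    _ = c * n * G s + (1 - c * n) * (A n * s ^ n) := by ring
    _ ≤ c * n * G s + (1 - c * n) * G s := by gcongr
    _ = G s := by ring

end

section

variable {d : ℕ}

open Filter Topology

/-! ### Optimality -/

/-- A trigonometric polynomial without Hermite modes of order below `n`; after division by `τ^n`
it tends to a multiple of the Hermite polynomial of order `n` as `τ → 0`. -/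
def extremal (n : ℕ) (i₀ : Fin d) (τ : ℝ) : Space d → ℝ :=
  trig n i₀ (fun j => j * τ) (fun j => altChoose n j * Real.exp ((j * τ) ^ 2 / 2))
    (-(n * (Real.pi / 2)))

theorem integral_extremal_mul_hermiteMulti {n : ℕ} {i₀ : Fin d} {τ : ℝ} {k : Fin d → ℕ}
    (hk : ∑ j, k j < n) : ∫ x, extremal n i₀ τ x * hermiteMulti k x ∂(gaussian d) = 0 := by
  refine integral_trig_mul_hermiteMulti k fun m hm => ?_
  -- The amplitude `exp (t²/2)` cancels the Gaussian factor of the cosine integral. The moments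
  -- become `n`-th differences of `j^m`, which vanish for `m < n`.
  have h : ∀ j : ℕ, altChoose n j * Real.exp ((j * τ) ^ 2 / 2) * (j * τ) ^ m *
      Real.exp (-(j * τ) ^ 2 / 2) = altChoose n j * (j : ℝ) ^ m * τ ^ m := by
    intro j
    have h1 : Real.exp ((j * τ) ^ 2 / 2) * Real.exp (-(j * τ) ^ 2 / 2) = 1 := by
      rw [← Real.exp_add, neg_div, add_neg_cancel, Real.exp_zero]
    calc _ = altChoose n j * (j * τ) ^ m *
          (Real.exp ((j * τ) ^ 2 / 2) * Real.exp (-(j * τ) ^ 2 / 2)) := by ring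
      _ = _ := by rw [h1]; ring
  simp only [h]
  rw [← Finset.sum_mul, sum_altChoose_mul_pow_of_lt (hm.trans_lt hk), zero_mul]

theorem exp_sq_mul_exp_neg_sub_sq (a b : ℝ) :
    Real.exp (a ^ 2 / 2) * Real.exp (b ^ 2 / 2) * Real.exp (-(a - b) ^ 2 / 2) =
      Real.exp (a * b) := by
  rw [← Real.exp_add, ← Real.exp_add]
  ring_nf

theorem exp_sq_mul_exp_neg_add_sq (a b : ℝ) :
    Real.exp (a ^ 2 / 2) * Real.exp (b ^ 2 / 2) * Real.exp (-(a + b) ^ 2 / 2) =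
      Real.exp (-(a * b)) := by
  rw [← Real.exp_add, ← Real.exp_add]
  ring_nf

theorem integral_extremal_sq (n : ℕ) (i₀ : Fin d) (τ : ℝ) :
    ∫ x, extremal n i₀ τ x ^ 2 ∂(gaussian d) =
      ∑ j ∈ Finset.range (n + 1), ∑ l ∈ Finset.range (n + 1), altChoose n j * altChoose n l *
        ((Real.exp (j * l * τ ^ 2) + (-1) ^ n * Real.exp (-(j * l * τ ^ 2))) / 2) := by
  -- The phase is chosen to give this sign, so that in the power series only the orders of the
  -- parity of `n` survive and order `n` is present.
  have hcos : Real.cos (2 * -(n * (Real.pi / 2))) = (-1) ^ n := by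
    rw [show 2 * -(n * (Real.pi / 2)) = -(n * Real.pi) by ring, Real.cos_neg,
      Real.cos_nat_mul_pi]
  simp only [extremal, integral_trig_sq, hcos]
  refine Finset.sum_congr rfl fun j _ => Finset.sum_congr rfl fun l _ => ?_
  rw [show (j : ℝ) * l * τ ^ 2 = j * τ * (l * τ) by ring, ← exp_sq_mul_exp_neg_sub_sq,
    ← exp_sq_mul_exp_neg_add_sq]
  ring

theorem norm_grad_extremal_sq (n : ℕ) (i₀ : Fin d) (τ : ℝ) (x : Space d) :
    ‖grad (extremal n i₀ τ) x‖ ^ 2 = trig n i₀ (fun j => j * τ)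
      (fun j => altChoose n j * Real.exp ((j * τ) ^ 2 / 2) * (j * τ))
      (-(n * (Real.pi / 2)) + Real.pi / 2) x ^ 2 := by
  rw [EuclideanSpace.norm_sq_eq, Finset.sum_eq_single i₀]
  · simp only [grad, extremal]
    rw [fderiv_trig, if_pos rfl, Real.norm_eq_abs, sq_abs]
  · intro i _ hi
    simp only [grad, extremal]
    rw [fderiv_trig, if_neg hi]
    simp
  · simp

theorem integral_norm_grad_extremal_sq (n : ℕ) (i₀ : Fin d) (τ : ℝ) :
    ∫ x, ‖grad (extremal n i₀ τ) x‖ ^ 2 ∂(gaussian d) =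
      ∑ j ∈ Finset.range (n + 1), ∑ l ∈ Finset.range (n + 1), altChoose n j * altChoose n l *
        (j * l * τ ^ 2 * (Real.exp (j * l * τ ^ 2) - (-1) ^ n * Real.exp (-(j * l * τ ^ 2)))
          / 2) := by
  have hcos : Real.cos (2 * (-(n * (Real.pi / 2)) + Real.pi / 2)) = -(-1) ^ n := by
    rw [show 2 * (-(n * (Real.pi / 2)) + Real.pi / 2) = Real.pi - n * Real.pi by ring,
      Real.cos_pi_sub, Real.cos_nat_mul_pi]
  simp only [norm_grad_extremal_sq, integral_trig_sq, hcos]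
  refine Finset.sum_congr rfl fun j _ => Finset.sum_congr rfl fun l _ => ?_
  rw [show (j : ℝ) * l * τ ^ 2 = j * τ * (l * τ) by ring, ← exp_sq_mul_exp_neg_sub_sq,
    ← exp_sq_mul_exp_neg_add_sq]
  ring

theorem exists_near_extremal {n : ℕ} (i₀ : Fin d) {c : ℝ} (hc : 0 ≤ c) (hcn : c * n < 1) :
    ∃ τ : ℝ, c * ∫ x, ‖grad (extremal n i₀ τ) x‖ ^ 2 ∂(gaussian d) <
      ∫ x, extremal n i₀ τ x ^ 2 ∂(gaussian d) := by
  obtain ⟨s, hs, h⟩ := exists_mul_lt_of_hasSum (sqCoeff_nonneg n) (sqCoeff_self_pos n)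
    (hasSum_sqCoeff n) (hasSum_nat_mul_sqCoeff n) hc hcn
  refine ⟨√s, ?_⟩
  rw [integral_extremal_sq, integral_norm_grad_extremal_sq, Real.sq_sqrt hs.le]
  exact h

/-- Perturbations `1 + ε f` of the constant `1` by a bounded `f` without low Hermite modes. -/
theorem admissible_one_add_mul {n : ℕ} {f : Space d → ℝ} (hn : 1 ≤ n) (hf : Continuous f)
    {M ε : ℝ} (hM : ∀ x, |f x| ≤ M) (hε : 0 ≤ ε) (hεM : ε * M < 1)
    (hH : ∀ k : Fin d → ℕ, ∑ j, k j < n →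
      ∫ x, f x * hermiteMulti k x ∂(gaussian d) = 0) :
    Admissible n fun x => 1 + ε * f x := by
  have hεf : ∀ x, |ε * f x| ≤ ε * M := fun x => by
    rw [abs_mul, abs_of_nonneg hε]
    exact mul_le_mul_of_nonneg_left (hM x) hε
  have hint : ∀ k, Integrable (fun x => f x * hermiteMulti k x) (gaussian d) := fun k =>
    (expGrowth_of_bounded hf hM).memLp.integrable_mul (expGrowth_hermiteMulti k).memLp
  have hHint : ∀ k : Fin d → ℕ, Integrable (hermiteMulti k) (gaussian d) := fun k =>
    (expGrowth_hermiteMulti k).memLp.integrable one_le_two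
  -- Below order `n`, including `k = 0`, the perturbation contributes nothing and the coefficients
  -- are those of the constant 1.
  have key : ∀ k : Fin d → ℕ, ∑ j, k j < n →
      ∫ x, (1 + ε * f x) * hermiteMulti k x ∂(gaussian d) =
        ∫ x, hermiteMulti k x ∂(gaussian d) := by
    intro k hk
    have heq : ∀ x, (1 + ε * f x) * hermiteMulti k x =
        hermiteMulti k x + ε * (f x * hermiteMulti k x) := fun x => by ring
    simp only [heq]
    rw [integral_add (hHint k) ((hint k).const_mul ε), integral_const_mul, hH k hk]
    simp
  refine ⟨?_, Eventually.of_forall fun x => ?_, ?_, fun k hk0 hk => ?_⟩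
  · refine memLp_top_of_bound (Continuous.aestronglyMeasurable (by fun_prop)) (1 + ε * M)
      (Eventually.of_forall fun x => ?_)
    refine (norm_add_le _ _).trans ?_
    rw [norm_one]
    exact add_le_add_right (hεf x) 1
  · linarith [(abs_le.1 (hεf x)).1]
  · simpa [hermiteMulti_zero] using key 0 (by simpa using Nat.lt_of_lt_of_le Nat.zero_lt_one hn)
  · rw [key k hk]
    refine integral_hermiteMulti ?_
    rintro rfl
    simp at hk0

theorem grad_one_add_mul {f : Space d → ℝ} (hf : ContDiff ℝ ∞ f) (ε : ℝ) (x : Space d) :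
    grad (fun x => 1 + ε * f x) x = ε • grad f x := by
  ext i
  simp only [grad, PiLp.smul_apply, smul_eq_mul]
  rw [fderiv_const_add, fderiv_const_mul (hf.differentiable (by simp) x)]
  simp

/-- The classical gradient is one candidate in the infimum defining `fisher`, which suffices for an
upper bound. -/
theorem fisher_le {w : Space d → ℝ} (hw : ContDiff ℝ ∞ w) {m : ℝ} (hm : 0 < m)
    (hmw : ∀ x, m ≤ w x) (hi : Integrable (fun x => ‖grad w x‖ ^ 2) (gaussian d)) :
    fisher w ≤ ENNReal.ofReal ((∫ x, ‖grad w x‖ ^ 2 ∂(gaussian d)) / m) := by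
  refine (iInf₂_le (grad w) (hasWeakGradient_grad hw)).trans ?_
  rw [← integral_div, ofReal_integral_eq_lintegral_ofReal (hi.div_const m)
    (Eventually.of_forall fun x => by positivity)]
  refine lintegral_mono fun x => ?_
  rw [ENNReal.ofReal_div_of_pos hm, ENNReal.ofReal_pow (norm_nonneg _), ofReal_norm]
  gcongr
  exact hmw x

theorem H1_le {n : ℕ} {w : Space d → ℝ} (h : Admissible n w) {η : ℝ} (hη0 : 0 ≤ η)
    (hη1 : η < 1) (hw : ∀ x, |w x - 1| ≤ η) : H1 w ≤ (1 + η) / (2 * (1 - η)) := by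
  have h1 : (eLpNorm w ∞ volume).toReal ≤ 1 + η := by
    refine ENNReal.toReal_le_of_le_ofReal (by linarith) ?_
    rw [eLpNorm_exponent_top]
    refine eLpNormEssSup_le_of_ae_bound (Eventually.of_forall fun x => ?_)
    have := abs_le.1 (hw x)
    rw [Real.norm_eq_abs, abs_le]
    constructor <;> linarith
  have h2 : 1 - η ≤ essInf w volume :=
    le_essInf_of_ae_le _ (Eventually.of_forall fun x => by
      linarith [(abs_le.1 (hw x)).1]) h.isCoboundedUnder_ge
  have h3 : ImprovedLogSobolev.h1 (essInf w volume) ≤ 1 / 2 / (1 - η) :=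
    (h1_antitoneOn (Set.mem_Ici.2 (by linarith)) h.essInf_nonneg h2).trans
      (h1_le_inv (by linarith) (by linarith))
  calc H1 w ≤ (1 + η) * (1 / 2 / (1 - η)) :=
        mul_le_mul h1 h3 (h1_pos h.essInf_nonneg).le (by linarith)
    _ = _ := by field_simp

theorem exists_admissible_lt {n : ℕ} (hd : 1 ≤ d) (hn : 1 ≤ n) {c : ℝ} (hc : 0 ≤ c)
    (hcn : c * n < 1) {δ : ℝ} (hδ : 0 < δ) :
    ∃ w : Space d → ℝ, Admissible n w ∧ ContDiff ℝ ∞ w ∧ (∀ x, |w x - 1| ≤ δ) ∧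
      ENNReal.ofReal (c * H1 w) * fisher w < ENNReal.ofReal (entropy w) := by
  obtain ⟨τ, hτ⟩ := exists_near_extremal (d := d) ⟨0, hd⟩ hc hcn
  set f : Space d → ℝ := extremal n ⟨0, hd⟩ τ with hfdef
  set F := ∫ x, f x ^ 2 ∂(gaussian d) with hF
  set D := ∫ x, ‖grad f x‖ ^ 2 ∂(gaussian d) with hD
  have hD0 : 0 ≤ D := integral_nonneg fun x => by positivity
  have hfc : ContDiff ℝ ∞ f := contDiff_trig
  obtain ⟨M, hM0, hM⟩ : ∃ M : ℝ, 0 < M ∧ ∀ x, |f x| ≤ M :=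
    ⟨(∑ j ∈ Finset.range (n + 1), |altChoose n j * Real.exp ((j * τ) ^ 2 / 2)|) + 1,
      by positivity, fun x => (abs_trig_le x).trans (by linarith)⟩
  have hgi : Integrable (fun x => ‖grad f x‖ ^ 2) (gaussian d) := by
    simp only [hfdef, norm_grad_extremal_sq]
    exact expGrowth_trig.memLp.integrable_sq
  -- The factor is the total loss when `|w - 1| ≤ η`: `(1 + η) / (2 (1 - η))` from `H1`, `1 / (1 -
  -- η)` from the Fisher information, and `2 (1 + η)` from the entropy. It tends to 1.
  have hlim : ∀ᶠ η : ℝ in 𝓝[>] 0, c * D * ((1 + η) / (1 - η)) ^ 2 < F := by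
    refine nhdsWithin_le_nhds ?_
    have hcont : ContinuousAt (fun η : ℝ => c * D * ((1 + η) / (1 - η)) ^ 2) 0 := by
      refine continuousAt_const.mul (ContinuousAt.pow (ContinuousAt.div ?_ ?_ ?_) 2)
      · fun_prop
      · fun_prop
      · norm_num
    refine hcont.tendsto.eventually_lt_const ?_
    simpa using hτ
  obtain ⟨η, hη, hη0, hη1⟩ := (hlim.and (Ioo_mem_nhdsGT (lt_min hδ zero_lt_one))).exists
  have hηδ : η < δ := hη1.trans_le (min_le_left _ _)
  replace hη1 : η < 1 := hη1.trans_le (min_le_right _ _)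
  -- This size makes the perturbation `ε f` at most `η` in absolute value, with `η < min δ 1`.
  set ε := η / M with hε
  have hε0 : 0 < ε := by positivity
  have hεM : ε * M = η := div_mul_cancel₀ _ hM0.ne'
  have hw := admissible_one_add_mul hn hfc.continuous hM hε0.le (hεM ▸ hη1)
    fun k hk => integral_extremal_mul_hermiteMulti hk
  set w : Space d → ℝ := fun x => 1 + ε * f x with hwdef
  have hwη : ∀ x, |w x - 1| ≤ η := fun x => by
    rw [← hεM, hwdef, add_sub_cancel_left, abs_mul, abs_of_pos hε0]
    exact mul_le_mul_of_nonneg_left (hM x) hε0.le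
  have hwc : ContDiff ℝ ∞ w := by fun_prop
  have hgrad : ∀ x, ‖grad w x‖ ^ 2 = ε ^ 2 * ‖grad f x‖ ^ 2 := fun x => by
    rw [grad_one_add_mul hfc, norm_smul, mul_pow, Real.norm_eq_abs, sq_abs]
  have hfisher : fisher w ≤ ENNReal.ofReal (ε ^ 2 * D / (1 - η)) := by
    have h := fisher_le hwc (m := 1 - η) (by linarith)
      (fun x => by linarith [(abs_le.1 (hwη x)).1])
      (by simpa only [hgrad] using hgi.const_mul (ε ^ 2))
    simpa only [hgrad, integral_const_mul] using h
  have hent : 1 / 2 / (1 + η) * (ε ^ 2 * F) ≤ entropy w := by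
    have h := hw.le_entropy (M := 1 + η) (fun x => by linarith [(abs_le.1 (hwη x)).2])
      fun x => by linarith [(abs_le.1 (hwη x)).1]
    rw [← hw.integral_sub_one_sq] at h
    have h2 : ∫ x, (w x - 1) ^ 2 ∂(gaussian d) = ε ^ 2 * F := by
      rw [hF, ← integral_const_mul]
      simp only [hwdef, add_sub_cancel_left, mul_pow]
    rw [h2] at h
    refine le_trans (mul_le_mul_of_nonneg_right (inv_le_h1 (by linarith)) ?_) h
    rw [← h2]
    exact integral_nonneg fun x => by positivity
  refine ⟨w, hw, hwc, fun x => (hwη x).trans hηδ.le, ?_⟩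
  have h1η : 0 < 1 - η := by linarith
  have hlt : c * ((1 + η) / (2 * (1 - η))) * (ε ^ 2 * D / (1 - η)) <
      1 / 2 / (1 + η) * (ε ^ 2 * F) := by
    calc c * ((1 + η) / (2 * (1 - η))) * (ε ^ 2 * D / (1 - η)) =
        1 / 2 / (1 + η) * ε ^ 2 * (c * D * ((1 + η) / (1 - η)) ^ 2) := by
          field_simp
      _ < 1 / 2 / (1 + η) * ε ^ 2 * F := by gcongr
      _ = _ := by ring
  have hpos : 0 ≤ c * ((1 + η) / (2 * (1 - η))) * (ε ^ 2 * D / (1 - η)) := by positivity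
  calc ENNReal.ofReal (c * H1 w) * fisher w ≤
      ENNReal.ofReal (c * ((1 + η) / (2 * (1 - η)))) *
        ENNReal.ofReal (ε ^ 2 * D / (1 - η)) := by
        refine mul_le_mul' (ENNReal.ofReal_le_ofReal ?_) hfisher
        exact mul_le_mul_of_nonneg_left (H1_le hw hη0.le hη1 hwη) hc
    _ = ENNReal.ofReal (c * ((1 + η) / (2 * (1 - η))) * (ε ^ 2 * D / (1 - η))) :=
        (ENNReal.ofReal_mul (by positivity)).symm
    _ < ENNReal.ofReal (entropy w) :=
        (ENNReal.ofReal_lt_ofReal_iff_of_nonneg hpos).2 (hlt.trans_le hent)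

end

end ImprovedLogSobolev

end

open ImprovedLogSobolev in
/-- The improved logarithmic Sobolev inequality, and the optimality of its constant: `1 / n`
cannot be lowered, not even for smooth functions that are uniformly close to `1`. -/
theorem theorem1 (d n : ℕ) (hd : 1 ≤ d) (hn : 1 ≤ n) :
    (∀ w : Space d → ℝ, Admissible n w →
      ENNReal.ofReal (entropy w) ≤ ENNReal.ofReal (H1 w / n) * fisher w) ∧
    (∀ c : ℝ, c < 1 / n → ∀ δ : ℝ, 0 < δ →
      ∃ w : Space d → ℝ, Admissible n w ∧ ContDiff ℝ ∞ w ∧ (∀ x, |w x - 1| ≤ δ) ∧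
        ENNReal.ofReal (c * H1 w) * fisher w < ENNReal.ofReal (entropy w)) := by
  refine ⟨fun w hw => hw.ofReal_entropy_le hn, fun c hc δ hδ => ?_⟩
  have hn0 : (0 : ℝ) < n := by exact_mod_cast hn
  -- For negative `c` the constant `ENNReal.ofReal (c * H1 w)` is 0, so `c` may be replaced by `max
  -- c 0`.
  have hcn : max c 0 * n < 1 := by
    rw [← lt_div_iff₀ hn0]
    exact max_lt hc (by positivity)
  obtain ⟨w, hw, hwc, hwδ, h⟩ := exists_admissible_lt hd hn (le_max_right c 0) hcn hδ
  refine ⟨w, hw, hwc, hwδ, lt_of_le_of_lt ?_ h⟩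
  gcongr
  · exact hw.H1_pos.le
  · exact le_max_left c 0
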